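/- Let $\mathcal N$ be a von Neumann algebra (acting on some Hilbert space), and let $\{E(t)\}_{t\ge 0}$ be a discrete product system over $\mathcal N$: a family of $W^*$-correspondences over $\mathcal N$ (self-dual right Hilbert modules with a normal left action of $\mathcal N$ by adjointable operators) with $E(0)=\mathcal N$ and with fixed isomorphisms of correspondences $E(s)\otimes_{\mathcal N}E(t)\simeq E(s+t)$ for $s,t\ge 0$, the tensor product being the composition of $W^*$-correspondences. Let $\{T_t\}_{t\ge 0}$ be a completely contractive covariant representation of $\{E(t)\}$ on a Hilbert space $H$: each $T_t:E(t)\to B(H)$ is linear, completely contractive and continuous from the $\sigma$-topology of $E(t)$ to the $\sigma$-weak topology, $T_0$ is a $*$-representation of $\mathcal N$ on $H$, and $T_{s+t}(\xi\otimes\eta)=T_s(\xi)T_t(\eta)$ for $\xi\in E(s)$, $\eta\in E(t)$. Let $E(t)\otimes_{T_0}H$ be the Hausdorff completion of the algebraic tensor product $E(t)\otimes H$ in $\langle\xi\otimes h,\eta\otimes k\rangle=\langle h,T_0(\langle\xi,\eta\rangle)k\rangle$. Then for each $t$ there is a contraction $\widetilde T_t:E(t)\otimes_{T_0}H\to H$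 with $\widetilde T_t(\xi\otimes h)=T_t(\xi)h$. For $S$ in the commutant $T_0(\mathcal N)'$ (which is $\mathcal N'$ when $\mathcal N\subseteq B(H)$ and $T_0$ is the identity representation) and $t\ge0$ put $$\Theta_t(S)=\widetilde T_t(1_{E(t)}\otimes S)\widetilde T_t^{*}.$$ Then each $\Theta_t$ is a normal, contractive, completely positive linear map of $T_0(\mathcal N)'$ into itself, and $\Theta_{s+t}=\Theta_s\circ\Theta_t$ for all $s,t\ge 0$, with $\Theta_0(S)=T_0(1)S$ (so $\Theta_0$ is the identity when $T_0$ is unital). Moreover, all $\Theta_t$ are unital if and only if $\{T_t\}$ is fully coisometric, i.e. $\widetilde T_t\widetilde T_t^{*}=1_H$ for all $t$; and every $\Theta_t$ is a (not necessarily unital) $*$-endomorphism of $T_0(\mathcal N)'$ if $\{T_t\}$ is isometric, i.e. $T_t(\xi)^*T_t(\eta)=T_0(\langle\xi,\eta\rangle)$ for all $t$ and all $\xi,\eta\in E(t)$. -/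

import Mathlib

open scoped TensorProduct InnerProductSpace NNReal CStarAlgebra

noncomputable section

/-! ### Von Neumann algebras as C*-algebras, and the `σ`-weak topology -/

namespace VonNeumannAlgebra

variable {H : Type*} [NormedAddCommGroup H] [InnerProductSpace ℂ H] [CompleteSpace H]

instance instSMulMemClassComplex : SMulMemClass (VonNeumannAlgebra H) ℂ (H →L[ℂ] H) where
  smul_mem {M} r _ hx := M.toStarSubalgebra.smul_mem hx r

theorem isClosed_coe (M : VonNeumannAlgebra H) : IsClosed (M : Set (H →L[ℂ] H)) := by
  rw [← M.centralizer_centralizer]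
  exact Set.isClosed_centralizer _

instance instCStarAlgebra (M : VonNeumannAlgebra H) : CStarAlgebra M :=
  StarSubalgebra.cstarAlgebra M (h_closed := M.isClosed_coe)

instance instPartialOrderCoe (M : VonNeumannAlgebra H) : PartialOrder M :=
  CStarAlgebra.spectralOrder M

instance instStarOrderedRingCoe (M : VonNeumannAlgebra H) : StarOrderedRing M :=
  CStarAlgebra.spectralOrderedRing M

end VonNeumannAlgebra

/-- The `σ`-weak topology on `B(H)`: the topology induced by the functionals
`x ↦ ∑ ⟪aₙ, x bₙ⟫` with `∑ ‖aₙ‖² < ∞` and `∑ ‖bₙ‖² < ∞`. -/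
abbrev sigmaWeakTopology (H : Type*) [NormedAddCommGroup H] [InnerProductSpace ℂ H] :
    TopologicalSpace (H →L[ℂ] H) :=
  ⨅ (a : ℕ → H) (b : ℕ → H) (_ : Summable fun n => ‖a n‖ ^ 2) (_ : Summable fun n => ‖b n‖ ^ 2),
    TopologicalSpace.induced (fun x : H →L[ℂ] H => ∑' n, ⟪a n, x (b n)⟫_ℂ) inferInstance

/-- The `σ`-weak topology on a von Neumann algebra, as a subspace of `B(H)`. -/
abbrev VonNeumannAlgebra.sigmaWeak {H : Type*} [NormedAddCommGroup H] [InnerProductSpace ℂ H]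
    [CompleteSpace H] (M : VonNeumannAlgebra H) : TopologicalSpace M :=
  TopologicalSpace.induced (fun x : M => (x : H →L[ℂ] H)) (sigmaWeakTopology H)

/-! ### Hilbert modules and correspondences over a von Neumann algebra -/

section Modules

variable {K : Type*} [NormedAddCommGroup K] [InnerProductSpace ℂ K] [CompleteSpace K]

/-- A right Hilbert C*-module `E` over `N` (completeness is required separately, through
`CompleteSpace E`). The `N`-valued inner product is conjugate linear in the first and linear in the
second variable, the right action is written `rsmul ξ a = ξ · a`, and the given norm of `E` is the
one defined by the inner product. (Mathlib's `CStarModule` is about modules that satisfy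
`⟪x, a • y⟫ = a * ⟪x, y⟫`, that is, about left modules.) -/
class HilbertModule (N : VonNeumannAlgebra K) (E : Type*) [NormedAddCommGroup E]
    [NormedSpace ℂ E] where
  ip : E →ₗ⋆[ℂ] E →ₗ[ℂ] N
  rsmul : E →ₗ[ℂ] N →ₗ[ℂ] E
  rsmul_one : ∀ ξ, rsmul ξ 1 = ξ
  rsmul_mul : ∀ ξ a b, rsmul ξ (a * b) = rsmul (rsmul ξ a) b
  ip_rsmul : ∀ ξ η a, ip ξ (rsmul η a) = ip ξ η * a
  star_ip : ∀ ξ η, star (ip ξ η) = ip η ξ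
  ip_self_nonneg : ∀ ξ, 0 ≤ (ip ξ ξ : K →L[ℂ] K)
  norm_sq_eq : ∀ ξ, ‖ξ‖ ^ 2 = ‖ip ξ ξ‖

/-- A C*-correspondence over `N`: a right Hilbert module with a left action of `N` that is a
`*`-homomorphism into the adjointable module maps (the left action is not required to be unital). -/
class CStarCorrespondence (N : VonNeumannAlgebra K) (E : Type*) [NormedAddCommGroup E]
    [NormedSpace ℂ E] extends HilbertModule N E where
  lsmul : N →ₙₐ[ℂ] (E →L[ℂ] E)
  lsmul_rsmul : ∀ a ξ b, lsmul a (rsmul ξ b) = rsmul (lsmul a ξ) b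
  ip_lsmul : ∀ a ξ η, ip (lsmul a ξ) η = ip ξ (lsmul (star a) η)

/-- A W*-correspondence over `N`: a C*-correspondence that is self-dual (every bounded module map
`E → N` is `⟨ξ, ·⟩` for some `ξ`) and whose left action is normal. The functionals `g(⟨ξ, · η⟩)`,
with `g` in the predual of `N`, span a norm dense subspace of the predual of the adjointable
operators, so that normality of the left action means that each `a ↦ ⟨ξ, a η⟩` is
`σ`-weakly continuous. -/
class WStarCorrespondence (N : VonNeumannAlgebra K) (E : Type*) [NormedAddCommGroup E]
    [NormedSpace ℂ E] extends CStarCorrespondence N E where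
  self_dual : ∀ φ : E →L[ℂ] N, (∀ ξ a, φ (rsmul ξ a) = φ ξ * a) → ∃ ζ, ∀ ξ, φ ξ = ip ζ ξ
  normal : ∀ ξ η, @Continuous N N N.sigmaWeak N.sigmaWeak fun a => ip ξ (lsmul a η)

open HilbertModule CStarCorrespondence

/-- The `σ`-topology on a Hilbert module over `N ⊆ B(K)`: the topology defined by the functionals
`∑ wₙ(⟨ηₙ, ·⟩)` with `wₙ` normal functionals on `N`, `∑ ‖wₙ‖ ‖ηₙ‖ < ∞`. As a normal functional `w`
on `N` is of the form `∑ ⟪aₖ, · bₖ⟫` with `∑ ‖aₖ‖ ‖bₖ‖` arbitrarily close to `‖w‖`, it is enough to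
use vector functionals `wₙ = ⟪aₙ, · bₙ⟫`. -/
abbrev sigmaTopology (N : VonNeumannAlgebra K) (E : Type*) [NormedAddCommGroup E] [NormedSpace ℂ E]
    [HilbertModule N E] : TopologicalSpace E :=
  ⨅ (η : ℕ → E) (a : ℕ → K) (b : ℕ → K) (_ : Summable fun n => ‖a n‖ * ‖η n‖ * ‖b n‖),
    TopologicalSpace.induced
      (fun ξ : E => ∑' n, ⟪a n, (ip (η n) ξ : N).1 (b n)⟫_ℂ) inferInstance

/-- A subset of a Hilbert module over `N ⊆ B(K)` is `σ`-strongly dense if it is dense for the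
topology of the seminorms `ξ ↦ w(⟨ξ, ξ⟩)^{1/2}`, with `w = ∑ ⟪aₙ, · aₙ⟫` a positive normal
functional on `N`. -/
def SigmaStronglyDense (N : VonNeumannAlgebra K) {E : Type*} [NormedAddCommGroup E]
    [NormedSpace ℂ E] [HilbertModule N E] (S : Set E) : Prop :=
  ∀ (ξ : E) (a : ℕ → K), (Summable fun n => ‖a n‖ ^ 2) → ∀ ε : ℝ, 0 < ε →
    ∃ η ∈ S, ∑' n, (⟪a n, (ip (ξ - η) (ξ - η) : N).1 (a n)⟫_ℂ).re < ε

/-- `m` exhibits the correspondence `G` as the composition `E ⊗_N F` of W*-correspondences, i.e.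
`ξ ⊗ η ↦ m ξ η` defines an isomorphism of correspondences `E ⊗_N F ≃ G`: `m` is a balanced bimodule
map, it satisfies `⟨ξ ⊗ η, ξ' ⊗ η'⟩ = ⟨η, ⟨ξ, ξ'⟩ η'⟩`, and the elementary tensors span a
`σ`-strongly dense subspace of the self-dual module `G`, so that `G` is the self-dual completion of
the algebraic tensor product. -/
structure IsCorrespondenceTensor (N : VonNeumannAlgebra K) {E F G : Type*}
    [NormedAddCommGroup E] [NormedSpace ℂ E] [NormedAddCommGroup F] [NormedSpace ℂ F]
    [NormedAddCommGroup G] [NormedSpace ℂ G] [WStarCorrespondence N E] [WStarCorrespondence N F]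
    [WStarCorrespondence N G] (m : E →ₗ[ℂ] F →ₗ[ℂ] G) : Prop where
  balanced : ∀ ξ (a : N) η, m (rsmul ξ a) η = m ξ (lsmul a η)
  map_lsmul : ∀ (a : N) ξ η, m (lsmul a ξ) η = lsmul a (m ξ η)
  map_rsmul : ∀ ξ η (a : N), m ξ (rsmul η a) = rsmul (m ξ η) a
  ip_map : ∀ ξ η ξ' η', (ip (m ξ η) (m ξ' η') : N) = ip η (lsmul (ip ξ ξ' : N) η')
  dense : SigmaStronglyDense N
    (Submodule.span ℂ (Set.range fun p : E × F => m p.1 p.2) : Set G)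

end Modules

/-! ### Discrete product systems and their covariant representations -/

section ProductSystems

open HilbertModule CStarCorrespondence

variable {K : Type*} [NormedAddCommGroup K] [InnerProductSpace ℂ K] [CompleteSpace K]

/-- The structure of a discrete product system over `N` on a family `E(t)`, `t ≥ 0`, of
W*-correspondences over `N`: an identification `E(0) = N` (as correspondences, where `N` has the
inner product `⟨a, b⟩ = a* b` and acts by multiplication) and isomorphisms
`E(s) ⊗ E(t) ≃ E(s + t)` of correspondences. -/
structure DiscreteProductSystem (N : VonNeumannAlgebra K) (E : ℝ≥0 → Type*)
    [∀ t, NormedAddCommGroup (E t)] [∀ t, NormedSpace ℂ (E t)]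
    [∀ t, WStarCorrespondence N (E t)] where
  unit : N ≃ₗ[ℂ] E 0
  ip_unit : ∀ a b, (ip (unit a) (unit b) : N) = star a * b
  lsmul_unit : ∀ a b : N, lsmul a (unit b) = unit (a * b)
  rsmul_unit : ∀ a b : N, rsmul (unit a) b = unit (a * b)
  mul : ∀ s t, E s →ₗ[ℂ] E t →ₗ[ℂ] E (s + t)
  isTensor : ∀ s t, IsCorrespondenceTensor N (mul s t)

variable {N : VonNeumannAlgebra K} {E : ℝ≥0 → Type*} [∀ t, NormedAddCommGroup (E t)]
  [∀ t, NormedSpace ℂ (E t)] [∀ t, WStarCorrespondence N (E t)]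

/-- A linear map `T : E → B(H)` on a Hilbert module is completely contractive: for every `n`, the
map `T⁽ⁿ⁾ : Mₙ(E) → Mₙ(B(H))` is contractive, where `Mₙ(E)` is the Hilbert module over `Mₙ(N)` with
`⟨x, y⟩ᵢⱼ = ∑ₖ ⟨xₖᵢ, yₖⱼ⟩`, and `Mₙ(N)`, `Mₙ(B(H))` have their C*-norms. -/
def CompletelyContractive (N : VonNeumannAlgebra K) {F : Type*} [NormedAddCommGroup F]
    [NormedSpace ℂ F] [HilbertModule N F] {H : Type*} [NormedAddCommGroup H]
    [InnerProductSpace ℂ H] [CompleteSpace H] (T : F →ₗ[ℂ] (H →L[ℂ] H)) : Prop :=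
  ∀ (n : ℕ) (x : Fin n → Fin n → F),
    ‖CStarMatrix.ofMatrix (Matrix.of fun i j => T (x i j))‖ ^ 2 ≤
      ‖CStarMatrix.ofMatrix (Matrix.of fun i j => ∑ k, (ip (x k i) (x k j) : N))‖

/-- A (completely contractive covariant) representation of a discrete product system on `H`. -/
structure CovariantRep (P : DiscreteProductSystem N E) (H : Type*) [NormedAddCommGroup H]
    [InnerProductSpace ℂ H] [CompleteSpace H] where
  T : ∀ t, E t →ₗ[ℂ] (H →L[ℂ] H)
  completelyContractive : ∀ t, CompletelyContractive N (T t)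
  continuous : ∀ t, @Continuous _ _ (sigmaTopology N (E t)) (sigmaWeakTopology H) (T t)
  zero_mul : ∀ a b : N, T 0 (P.unit (a * b)) = T 0 (P.unit a) * T 0 (P.unit b)
  zero_star : ∀ a : N, T 0 (P.unit (star a)) = star (T 0 (P.unit a))
  map_mul : ∀ s t ξ η, T (s + t) (P.mul s t ξ η) = T s ξ * T t η

/-- The `*`-representation `T₀` of `N = E(0)` on `H`. -/
def CovariantRep.σ {P : DiscreteProductSystem N E} {H : Type*} [NormedAddCommGroup H]
    [InnerProductSpace ℂ H] [CompleteSpace H] (R : CovariantRep P H) : N →⋆ₙₐ[ℂ] (H →L[ℂ] H) where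
  toFun a := R.T 0 (P.unit a)
  map_smul' c a := by simp
  map_zero' := by simp
  map_add' a b := by simp
  map_mul' := R.zero_mul
  map_star' := R.zero_star

end ProductSystems

/-! ### The Hilbert space `E ⊗_σ H` -/

section Gram

open HilbertModule

variable {K : Type*} [NormedAddCommGroup K] [InnerProductSpace ℂ K] [CompleteSpace K]
  {N : VonNeumannAlgebra K} {E : Type*} [NormedAddCommGroup E] [NormedSpace ℂ E]
  [HilbertModule N E]

theorem HilbertModule.rsmul_ip (ξ η : E) (a : N) : ip (rsmul ξ a) η = star a * (ip ξ η : N) := by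
  rw [← star_ip, ip_rsmul, star_mul, star_ip]

/-- In a C*-algebra, a self-adjoint `X` compresses to a negative element by its negative part `P`,
and it is of the form `Y* Y` if this compression vanishes. -/
theorem exists_negPart_compression {B : Type*} [CStarAlgebra B] (X : B) (hsa : IsSelfAdjoint X) :
    ∃ W P Y : B, star P = P ∧ P * X * P = -(star (W * P) * (W * P)) ∧
      (W * P = 0 → X = star Y * Y) := by
  let _ := CStarAlgebra.spectralOrder B
  have _ := CStarAlgebra.spectralOrderedRing B
  have hP0 : 0 ≤ X⁻ := CFC.negPart_nonneg X
  have hPsa : star (X⁻) = X⁻ := IsSelfAdjoint.of_nonneg hP0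
  obtain ⟨W, hW⟩ := CStarAlgebra.nonneg_iff_eq_star_mul_self.mp hP0
  obtain ⟨Y, hY⟩ := CStarAlgebra.nonneg_iff_eq_star_mul_self.mp (CFC.posPart_nonneg X)
  have h1 : X⁺ - X⁻ = X := CFC.posPart_sub_negPart X hsa
  have h2 : X⁺ * X⁻ = 0 := CFC.posPart_mul_negPart X
  generalize X⁻ = P at *
  generalize X⁺ = Q at *
  have h3 : X * P = -(P * P) := by
    rw [← h1, sub_mul, h2, zero_sub]
  have h4 : star (W * P) * (W * P) = P * P * P := by
    rw [star_mul, hPsa, mul_assoc P, ← mul_assoc (star W), ← hW, mul_assoc]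
  refine ⟨W, P, Y, hPsa, by rw [mul_assoc, h3, h4, mul_neg, mul_assoc], fun hZ => ?_⟩
  have h5 : star (P * P) * (P * P) = 0 := by
    rw [star_mul, hPsa, ← mul_assoc, ← h4, hZ, mul_zero, zero_mul]
  have h6 : P * P = 0 := (CStarRing.star_mul_self_eq_zero_iff _).mp h5
  have h7 : P = 0 := by
    rw [← CStarRing.star_mul_self_eq_zero_iff, hPsa, h6]
  rw [← h1, h7, sub_zero, hY]

/-- The Gram matrix `(⟨xᵢ, xⱼ⟩)` is positive, i.e. of the form `Y* Y`, in the matrices over `N`. -/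
theorem HilbertModule.exists_gram {ι : Type*} [Fintype ι] [DecidableEq ι] (x : ι → E) :
    ∃ Y : ι → ι → N, ∀ i j, (ip (x i) (x j) : N) = ∑ k, star (Y k i) * Y k j := by
  obtain ⟨X, hXa⟩ : ∃ X : CStarMatrix ι ι N, ∀ i j, X i j = ip (x i) (x j) :=
    ⟨CStarMatrix.ofMatrix (Matrix.of fun i j => ip (x i) (x j)), fun i j => rfl⟩
  have hsa : IsSelfAdjoint X := by
    ext i j
    rw [CStarMatrix.star_apply, hXa, hXa, star_ip]
  obtain ⟨W, P, Y, hPsa, hPX, hY⟩ := exists_negPart_compression X hsa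
  have hPs : ∀ a k, star (P a k) = P k a := fun a k => by rw [← CStarMatrix.star_apply, hPsa]
  have hZ0 : W * P = 0 := by
    refine CStarMatrix.ext fun i k => ?_
    have hdiag : (P * X * P) k k =
        ip (∑ i, rsmul (x i) (P i k)) (∑ j, rsmul (x j) (P j k)) := by
      rw [CStarMatrix.mul_apply]
      simp only [CStarMatrix.mul_apply, map_sum, LinearMap.sum_apply, ip_rsmul, rsmul_ip,
        Finset.sum_mul, hXa, hPs]
    generalize ∑ i, rsmul (x i) (P i k) = y at hdiag
    generalize W * P = Z at *
    have hsum : ∑ i, star (Z i k) * Z i k = -(ip y y : N) := by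
      rw [← hdiag, hPX, CStarMatrix.neg_apply, neg_neg, CStarMatrix.mul_apply]
      simp only [CStarMatrix.star_apply]
    have hv : ∀ v : K, ∑ i, ‖((Z i k : N) : K →L[ℂ] K) v‖ ^ 2 ≤ 0 := fun v => by
      have hpos : 0 ≤ (⟪v, ((ip y y : N) : K →L[ℂ] K) v⟫_ℂ).re :=
        ((ContinuousLinearMap.nonneg_iff_isPositive _).mp
          (ip_self_nonneg (N := N) y)).re_inner_nonneg_right v
      have h := congrArg (fun a : N => (⟪v, (a : K →L[ℂ] K) v⟫_ℂ).re) hsum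
      have e : ∀ i, (⟪v, ((star (Z i k) * Z i k : N) : K →L[ℂ] K) v⟫_ℂ).re
          = ‖((Z i k : N) : K →L[ℂ] K) v‖ ^ 2 := fun i => by
        have : ((star (Z i k) * Z i k : N) : K →L[ℂ] K) v
            = ContinuousLinearMap.adjoint ((Z i k : N) : K →L[ℂ] K)
              (((Z i k : N) : K →L[ℂ] K) v) := rfl
        rw [this, ContinuousLinearMap.adjoint_inner_right, inner_self_eq_norm_sq_to_K]
        norm_cast
      have hs : ((∑ i, star (Z i k) * Z i k : N) : K →L[ℂ] K) v
          = ∑ i, ((star (Z i k) * Z i k : N) : K →L[ℂ] K) v := by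
        rw [AddSubmonoidClass.coe_finsetSum, _root_.sum_apply]
      have hn : ((-(ip y y : N) : N) : K →L[ℂ] K) v = -(((ip y y : N) : K →L[ℂ] K) v) := rfl
      simp only [hs, hn, inner_sum, inner_neg_right, Complex.re_sum, Complex.neg_re, e] at h
      rw [h]
      linarith
    apply Subtype.ext
    ext v
    have h0 := (Finset.sum_eq_zero_iff_of_nonneg (fun i _ => sq_nonneg _)).mp
      (le_antisymm (hv v) (Finset.sum_nonneg fun i _ => sq_nonneg _)) i (Finset.mem_univ i)
    simpa using h0
  refine ⟨fun k i => Y k i, fun i j => ?_⟩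
  rw [← hXa, hY hZ0, CStarMatrix.mul_apply]
  simp only [CStarMatrix.star_apply]

end Gram

section InducedSpace

open HilbertModule

variable {K : Type*} [NormedAddCommGroup K] [InnerProductSpace ℂ K] [CompleteSpace K]
  {N : VonNeumannAlgebra K} (E : Type*) [NormedAddCommGroup E] [NormedSpace ℂ E]
  [HilbertModule N E] {H : Type*} [NormedAddCommGroup H] [InnerProductSpace ℂ H] [CompleteSpace H]

/-- The algebraic tensor product `E ⊗ H`, to be equipped with the pre-inner product defined
by `σ`. -/
@[nolint unusedArguments]
def PreInduced (_σ : N →⋆ₙₐ[ℂ] (H →L[ℂ] H)) : Type _ := E ⊗[ℂ] H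

variable (σ : N →⋆ₙₐ[ℂ] (H →L[ℂ] H))

namespace PreInduced

instance : AddCommGroup (PreInduced E σ) := inferInstanceAs (AddCommGroup (E ⊗[ℂ] H))

instance : Module ℂ (PreInduced E σ) := inferInstanceAs (Module ℂ (E ⊗[ℂ] H))

/-- The sesquilinear form with `⟨ξ ⊗ h, η ⊗ k⟩ = ⟪h, σ(⟨ξ, η⟩) k⟫`. -/
def form : E ⊗[ℂ] H →ₗ⋆[ℂ] E ⊗[ℂ] H →ₗ[ℂ] ℂ :=
  TensorProduct.lift
    (LinearMap.mk₂'ₛₗ (starRingEnd ℂ) (starRingEnd ℂ)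
      (fun (ξ : E) (h : H) => TensorProduct.lift
        (LinearMap.mk₂ ℂ (fun (η : E) (k : H) => ⟪h, σ (ip ξ η) k⟫_ℂ)
          (fun η η' k => by simp)
          (fun c η k => by simp)
          (fun η k k' => by simp)
          (fun c η k => by simp)))
      (fun ξ ξ' h => by ext η k; simp)
      (fun c ξ h => by ext η k; simp)
      (fun ξ h h' => by ext η k; simp)
      (fun c ξ h => by ext η k; simp [mul_comm]))

theorem form_tmul (ξ η : E) (h k : H) :
    form E σ (ξ ⊗ₜ h) (η ⊗ₜ k) = ⟪h, σ (ip ξ η) k⟫_ℂ := rfl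

theorem form_conj (u v : E ⊗[ℂ] H) : starRingEnd ℂ (form E σ v u) = form E σ u v := by
  induction u using TensorProduct.induction_on with
  | zero => simp
  | add u u' hu hu' => simp [hu, hu']
  | tmul ξ h =>
    induction v using TensorProduct.induction_on with
    | zero => simp
    | add v v' hv hv' => simp [hv, hv']
    | tmul η k =>
      rw [form_tmul, form_tmul, inner_conj_symm, ← star_ip, map_star,
        ContinuousLinearMap.star_eq_adjoint, ContinuousLinearMap.adjoint_inner_left]

/-- For a finite sum of elementary tensors, the form is a sum of squares. -/
theorem exists_sum_sq (u : E ⊗[ℂ] H) : ∃ (n : ℕ) (w : Fin n → H),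
    ∀ S : H →L[ℂ] H, (∀ a, S * σ a = σ a * S) →
      form E σ (TensorProduct.map LinearMap.id (S : H →ₗ[ℂ] H) u)
        (TensorProduct.map LinearMap.id (S : H →ₗ[ℂ] H) u) = ∑ k, ((‖S (w k)‖ : ℂ)) ^ 2 := by
  classical
  obtain ⟨n, x, h, hu⟩ : ∃ (n : ℕ) (x : Fin n → E) (h : Fin n → H), u = ∑ i, x i ⊗ₜ[ℂ] h i := by
    obtain ⟨s, hs⟩ := TensorProduct.exists_finset u
    refine ⟨s.card, fun i => (s.equivFin.symm i).1.1, fun i => (s.equivFin.symm i).1.2, ?_⟩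
    rw [hs, ← Finset.sum_coe_sort, ← s.equivFin.symm.sum_comp]
  obtain ⟨Y, hY⟩ := exists_gram (N := N) x
  refine ⟨n, fun k => ∑ j, σ (Y k j) (h j), fun S hS => ?_⟩
  have hS' : ∀ a v, S (σ a v) = σ a (S v) := fun a v => congrArg (fun A : H →L[ℂ] H => A v) (hS a)
  have hu' : TensorProduct.map LinearMap.id (S : H →ₗ[ℂ] H) u = ∑ i, x i ⊗ₜ[ℂ] S (h i) := by
    rw [hu, map_sum]
    rfl
  have key : ∀ k, (‖S (∑ j, σ (Y k j) (h j))‖ : ℂ) ^ 2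
      = ∑ i, ∑ j, ⟪S (h i), σ (star (Y k i) * Y k j) (S (h j))⟫_ℂ := fun k => by
    refine (inner_self_eq_norm_sq_to_K (𝕜 := ℂ) (S (∑ j, σ (Y k j) (h j)))).symm.trans ?_
    simp only [map_sum, sum_inner, inner_sum, hS']
    rw [Finset.sum_comm]
    refine Finset.sum_congr rfl fun i _ => Finset.sum_congr rfl fun j _ => ?_
    rw [map_mul, map_star, mul_apply_eq_comp,
      ContinuousLinearMap.star_eq_adjoint, ContinuousLinearMap.adjoint_inner_right]
  have e : form E σ (∑ i, x i ⊗ₜ[ℂ] S (h i)) (∑ i, x i ⊗ₜ[ℂ] S (h i))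
      = ∑ i, ∑ j, ∑ k, ⟪S (h i), σ (star (Y k i) * Y k j) (S (h j))⟫_ℂ := by
    simp only [map_sum, LinearMap.sum_apply, form_tmul, hY, _root_.sum_apply,
      inner_sum]
    rw [Finset.sum_comm]
  rw [hu', e]
  simp only [key]
  refine Eq.trans (Finset.sum_congr rfl fun i _ => Finset.sum_comm) Finset.sum_comm

theorem form_self (u : E ⊗[ℂ] H) : 0 ≤ (form E σ u u).re := by
  obtain ⟨n, w, h⟩ := exists_sum_sq E σ u
  have := h 1 (fun a => by rw [one_mul, mul_one])
  rw [show ((1 : H →L[ℂ] H) : H →ₗ[ℂ] H) = LinearMap.id from rfl, TensorProduct.map_id,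
    LinearMap.id_apply] at this
  rw [this]
  norm_cast
  positivity

instance : PreInnerProductSpace.Core ℂ (PreInduced E σ) where
  inner u v := form E σ u v
  conj_inner_symm u v := form_conj E σ u v
  re_inner_nonneg u := form_self E σ u
  add_left _ _ _ := LinearMap.map_add₂ _ _ _ _
  smul_left _ _ _ := LinearMap.map_smulₛₗ₂ _ _ _ _

instance : SeminormedAddCommGroup (PreInduced E σ) :=
  InnerProductSpace.Core.toSeminormedAddCommGroup (𝕜 := ℂ)

instance : InnerProductSpace ℂ (PreInduced E σ) := .ofCore _

end PreInduced

/-- The Hilbert space `E ⊗_σ H`: the Hausdorff completion of the algebraic tensor product `E ⊗ H`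
in the pre-inner product `⟨ξ ⊗ h, η ⊗ k⟩ = ⟪h, σ(⟨ξ, η⟩) k⟫`. -/
abbrev InducedSpace : Type _ := UniformSpace.Completion (PreInduced E σ)

variable {E}

namespace InducedSpace

/-- The canonical map from the algebraic tensor product to `E ⊗_σ H`. -/
def ofTensor : E ⊗[ℂ] H →ₗ[ℂ] InducedSpace E σ :=
  (UniformSpace.Completion.toComplₗᵢ (𝕜 := ℂ) (E := PreInduced E σ)).toLinearMap

/-- The elementary tensor `ξ ⊗ h` in `E ⊗_σ H`. -/
def tmul (ξ : E) (h : H) : InducedSpace E σ := ofTensor σ (ξ ⊗ₜ h)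

theorem inner_tmul (ξ η : E) (h k : H) :
    ⟪tmul σ ξ h, tmul σ η k⟫_ℂ = ⟪h, σ (ip ξ η) k⟫_ℂ :=
  UniformSpace.Completion.inner_coe (𝕜 := ℂ) (E := PreInduced E σ) _ _

theorem denseRange_ofTensor : DenseRange (ofTensor (E := E) σ) :=
  UniformSpace.Completion.denseRange_coe (α := PreInduced E σ)

theorem norm_ofTensor_sq (u : E ⊗[ℂ] H) : ‖ofTensor σ u‖ ^ 2 = (PreInduced.form E σ u u).re := by
  rw [← inner_self_eq_norm_sq (𝕜 := ℂ)]
  exact congrArg Complex.re (UniformSpace.Completion.inner_coe (𝕜 := ℂ) (E := PreInduced E σ) _ _)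

/-- The operator `1 ⊗ S` on `E ⊗_σ H`, for `S` in the commutant of `σ(N)`. -/
def ampl (S : H →L[ℂ] H) : InducedSpace E σ →L[ℂ] InducedSpace E σ :=
  (ofTensor σ ∘ₗ TensorProduct.map LinearMap.id (S : H →ₗ[ℂ] H)).extendOfNorm (ofTensor (E := E) σ)

theorem ampl_bound (S : H →L[ℂ] H) (hS : ∀ a, S * σ a = σ a * S) (u : E ⊗[ℂ] H) :
    ‖ofTensor σ (TensorProduct.map LinearMap.id (S : H →ₗ[ℂ] H) u)‖ ≤ ‖S‖ * ‖ofTensor σ u‖ := by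
  obtain ⟨n, w, h⟩ := PreInduced.exists_sum_sq E σ u
  have h1 := h 1 (fun a => by rw [one_mul, mul_one])
  rw [show ((1 : H →L[ℂ] H) : H →ₗ[ℂ] H) = LinearMap.id from rfl, TensorProduct.map_id,
    LinearMap.id_apply] at h1
  refine le_of_sq_le_sq ?_ (by positivity)
  rw [mul_pow, norm_ofTensor_sq, norm_ofTensor_sq, h S hS, h1]
  norm_cast
  rw [Finset.mul_sum]
  refine Finset.sum_le_sum fun k _ => ?_
  rw [← mul_pow]
  gcongr
  exact S.le_opNorm _

theorem ampl_tmul (S : H →L[ℂ] H) (hS : ∀ a, S * σ a = σ a * S) (ξ : E) (h : H) :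
    ampl σ S (tmul σ ξ h) = tmul σ ξ (S h) :=
  LinearMap.extendOfNorm_eq (denseRange_ofTensor σ) ⟨‖S‖, ampl_bound σ S hS⟩ _

/-- The operator `T̃ : E ⊗_σ H → H`, `ξ ⊗ h ↦ T(ξ) h`: the bounded extension of the linear map on
the algebraic tensor product that is so defined (and zero if that map is not bounded). -/
def tilde (T : E →ₗ[ℂ] (H →L[ℂ] H)) : InducedSpace E σ →L[ℂ] H :=
  (TensorProduct.lift (ContinuousLinearMap.coeLM ℂ ∘ₗ T)).extendOfNorm (ofTensor (E := E) σ)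

end InducedSpace

/-- The commutant `σ(N)'`, as a von Neumann algebra. -/
def repCommutant : VonNeumannAlgebra H where
  toStarSubalgebra := StarSubalgebra.centralizer ℂ (Set.range σ)
  centralizer_centralizer' := by
    simp

theorem mem_repCommutant {S : H →L[ℂ] H} : S ∈ repCommutant σ ↔ ∀ a, S * σ a = σ a * S := by
  refine StarSubalgebra.mem_centralizer_iff (R := ℂ) (s := Set.range σ) |>.trans ⟨fun h a => ?_,
    fun h => ?_⟩
  · exact (h _ ⟨a, rfl⟩).1.symm
  · rintro _ ⟨a, rfl⟩
    exact ⟨(h a).symm, by rw [← map_star, h]⟩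

/-- For the identity representation of `N ⊆ B(K)` on `K`, the commutant `σ(N)'` is `N'`. -/
theorem repCommutant_eq_commutant (σ : N →⋆ₙₐ[ℂ] (K →L[ℂ] K)) (h : ∀ a : N, σ a = a) :
    repCommutant σ = N.commutant := by
  ext S
  rw [mem_repCommutant, VonNeumannAlgebra.mem_commutant_iff]
  simp only [h, Subtype.forall]
  exact forall₂_congr fun _ _ => eq_comm

end InducedSpace

/-! ### The maps induced by a covariant representation -/

namespace CovariantRep

open HilbertModule

variable {K : Type*} [NormedAddCommGroup K] [InnerProductSpace ℂ K] [CompleteSpace K]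
  {N : VonNeumannAlgebra K} {E : ℝ≥0 → Type*} [∀ t, NormedAddCommGroup (E t)]
  [∀ t, NormedSpace ℂ (E t)] [∀ t, WStarCorrespondence N (E t)] {P : DiscreteProductSystem N E}
  {H : Type*} [NormedAddCommGroup H] [InnerProductSpace ℂ H] [CompleteSpace H]
  (R : CovariantRep P H)

/-- The operator `T̃ₜ : E(t) ⊗_{T₀} H → H`, `ξ ⊗ h ↦ Tₜ(ξ) h`. -/
def tilde (t : ℝ≥0) : InducedSpace (E t) R.σ →L[ℂ] H := InducedSpace.tilde R.σ (R.T t)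

/-- The operator `T̃ₜ (1 ⊗ S) T̃ₜ*` on `H`, for `S` in the commutant of `T₀(N)`. -/
def theta (t : ℝ≥0) (S : H →L[ℂ] H) : H →L[ℂ] H :=
  R.tilde t ∘L InducedSpace.ampl R.σ S ∘L ContinuousLinearMap.adjoint (R.tilde t)

/-- Each `(Tₜ, T₀)` is isometric: `Tₜ(ξ)* Tₜ(η) = T₀(⟨ξ, η⟩)`. -/
def IsIsometric : Prop :=
  ∀ t (ξ η : E t), star (R.T t ξ) * R.T t η = R.σ (ip ξ η)

/-- Each `(Tₜ, T₀)` is fully coisometric: the map `X ↦ T̃ₜ (X ⊗ 1) T̃ₜ*` on the adjointable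
operators of `E(t)` takes `1` to `1`, that is, `T̃ₜ T̃ₜ* = 1`. -/
def IsFullyCoisometric : Prop :=
  ∀ t, R.tilde t ∘L ContinuousLinearMap.adjoint (R.tilde t) = 1

end CovariantRep

end

open scoped TensorProduct InnerProductSpace NNReal CStarAlgebra

noncomputable section

/-! ### Positivity in matrices over C*-algebras and von Neumann algebras. -/

section MatrixPositivity

/-! Write `σ` for `T₀`. On the commutant of `σ(N)`, the amplification `S ↦ 1 ⊗ S` is a normal
`*`-homomorphism into the operators on `E(t) ⊗_σ H`, and `Θₜ` is its compression by the contraction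
`T̃ₜ`. Hence `Θₜ` is normal, contractive and completely positive, and `Θₜ(1) = T̃ₜ T̃ₜ*` gives the
criterion for unitality. If `T` is isometric then `T̃ₜ* T̃ₜ = 1`, which makes the compression
multiplicative. Both `T̃ₜ` and `1 ⊗ S` respect the left action of `N`, so `Θₜ(S)` commutes with
`σ(N)`.

Three points need work. Contractivity of `T̃ₜ` (`norm_lift_le_of_completelyContractive`) comes from
complete contractivity by normalising a finite family of vectors with the inverse square root of its
Gram matrix. It uses `Tₜ(ξ a) = Tₜ(ξ) σ(a)` (`T_rsmul`), which is derived from multiplicativity of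
`T` because self-duality makes every element of `E(t + 0)` of the form `ξ ⊗ 1`.

Normality of the amplification (`hasPairing_ampl`) holds because a factorisation `Y* Y` of a Gram
matrix turns `⟨u, (1 ⊗ S) v⟩` into a sum of terms `⟨wₗ, S zₗ⟩` with controlled norms.

For the semigroup law (`theta_add_time`), put `V = 1 ⊗ T̃ₜ* : E(s) ⊗_σ H → E(s + t) ⊗_σ H`. Then
`T̃ₛ₊ₜ = T̃ₛ V*` and `V* (1 ⊗ S) V = 1 ⊗ Θₜ(S)`. The first identity is checked on vectors `(ξ ⊗ η) ⊗
h`. The tensors `ξ ⊗ η` span only a `σ`-strongly dense subspace of `E(s + t)`; normality of `σ`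
turns this into norm density in the Hilbert space (`tmul_mem_closure`). -/

theorem exists_norm_sq_sub_star_mul_self {B : Type*} [CStarAlgebra B] (A : B) :
    ∃ Y : B, ((‖A‖ ^ 2 : ℝ) : ℂ) • (1 : B) - star A * A = star Y * Y := by
  let _ := CStarAlgebra.spectralOrder B
  have _ := CStarAlgebra.spectralOrderedRing B
  have h := CStarAlgebra.star_mul_le_algebraMap_norm_sq (a := A)
  rw [← sub_nonneg, CStarAlgebra.nonneg_iff_eq_star_mul_self,
    Algebra.algebraMap_eq_smul_one, ← Complex.coe_smul] at h
  exact h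

theorem CStarMatrix.sum_norm_sq_mulVec {H : Type*} [NormedAddCommGroup H] [InnerProductSpace ℂ H]
    [CompleteSpace H] {n : Type*} [Fintype n] (A : CStarMatrix n n (H →L[ℂ] H)) (v : n → H) :
    ∑ i, ∑ j, ⟪v i, (star A * A) i j (v j)⟫_ℂ = ((∑ i, ‖∑ j, A i j (v j)‖ ^ 2 : ℝ) : ℂ) := by
  simp only [CStarMatrix.mul_apply, CStarMatrix.star_apply, _root_.sum_apply, inner_sum,
    mul_apply_eq_comp, ContinuousLinearMap.star_eq_adjoint,
    ContinuousLinearMap.adjoint_inner_right]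
  push_cast
  have e : ∀ k, ((‖∑ j, A k j (v j)‖ : ℂ)) ^ 2 = ∑ i, ∑ j, ⟪A k i (v i), A k j (v j)⟫_ℂ :=
    fun k => by
      refine (inner_self_eq_norm_sq_to_K (𝕜 := ℂ) (∑ j, A k j (v j))).symm.trans ?_
      simp only [sum_inner, inner_sum]
      exact Finset.sum_comm
  simp only [e]
  refine Eq.trans (Finset.sum_congr rfl fun i _ => Finset.sum_comm) Finset.sum_comm

/-- A matrix over `B(H)` acts on `Hⁿ` with its C*-norm as a bound. -/
theorem CStarMatrix.sum_norm_sq_mulVec_le {H : Type*} [NormedAddCommGroup H]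
    [InnerProductSpace ℂ H] [CompleteSpace H] {n : Type*} [Fintype n] [DecidableEq n]
    (A : CStarMatrix n n (H →L[ℂ] H)) (v : n → H) :
    ∑ i, ‖∑ j, A i j (v j)‖ ^ 2 ≤ ‖A‖ ^ 2 * ∑ i, ‖v i‖ ^ 2 := by
  obtain ⟨B, hB⟩ := exists_norm_sq_sub_star_mul_self A
  have hA := sum_norm_sq_mulVec A v
  have hB' := sum_norm_sq_mulVec B v
  have e : ∀ i j, (((‖A‖ ^ 2 : ℝ) : ℂ) • (1 : CStarMatrix n n (H →L[ℂ] H))) i j (v j)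
      = if i = j then ((‖A‖ ^ 2 : ℝ) : ℂ) • v j else 0 := fun i j => by
    rw [CStarMatrix.smul_apply, CStarMatrix.one_apply]
    split_ifs <;> simp
  rw [← hB] at hB'
  have e2 : ∑ i, ∑ j, ⟪v i, (((‖A‖ ^ 2 : ℝ) : ℂ) • (1 : CStarMatrix n n (H →L[ℂ] H))) i j (v j)⟫_ℂ
      = ((‖A‖ ^ 2 * ∑ i, ‖v i‖ ^ 2 : ℝ) : ℂ) := by
    simp only [e]
    rw [Finset.mul_sum]
    push_cast
    refine Finset.sum_congr rfl fun i _ => ?_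
    rw [Finset.sum_eq_single i (fun j _ hj => by simp [hj.symm]) (by simp), if_pos rfl,
      inner_smul_right, inner_self_eq_norm_sq_to_K]
    rfl
  simp only [CStarMatrix.sub_apply, _root_.sub_apply, inner_sub_right,
    Finset.sum_sub_distrib] at hB'
  rw [e2, hA, ← Complex.ofReal_sub, Complex.ofReal_inj] at hB'
  have : 0 ≤ ∑ i, ‖∑ j, B i j (v j)‖ ^ 2 := Finset.sum_nonneg fun i _ => sq_nonneg _
  linarith

variable {H : Type*} [NormedAddCommGroup H] [InnerProductSpace ℂ H] [CompleteSpace H]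

/-- A self-adjoint matrix over a von Neumann algebra on `H` is positive if it is positive as an
operator on `Hⁿ`. -/
theorem VonNeumannAlgebra.cstarMatrix_nonneg (M : VonNeumannAlgebra H) {n : Type*} [Fintype n]
    [DecidableEq n] (X : CStarMatrix n n M) (hsa : IsSelfAdjoint X)
    (hX : ∀ v : n → H, 0 ≤ (∑ i, ∑ j, ⟪v i, (X i j : H →L[ℂ] H) (v j)⟫_ℂ).re) : 0 ≤ X := by
  obtain ⟨W, P, Y, hPsa, hPX, hY⟩ := exists_negPart_compression X hsa
  have hPs : ∀ a k, star (P a k) = P k a := fun a k => by rw [← CStarMatrix.star_apply, hPsa]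
  suffices hZ0 : W * P = 0 by
    rw [hY hZ0]
    exact star_mul_self_nonneg Y
  have sum_coe : ∀ (f : n → M) (v : H), ((∑ i, f i : M) : H →L[ℂ] H) v
      = ∑ i, (f i : H →L[ℂ] H) v := fun f v => by
    rw [AddSubmonoidClass.coe_finsetSum, _root_.sum_apply]
  have mul_coe : ∀ (a b : M) (v : H), ((a * b : M) : H →L[ℂ] H) v
      = (a : H →L[ℂ] H) ((b : H →L[ℂ] H) v) := fun a b v => rfl
  have star_coe : ∀ (a : M) (v w : H), ⟪v, ((star a : M) : H →L[ℂ] H) w⟫_ℂ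
      = ⟪(a : H →L[ℂ] H) v, w⟫_ℂ := fun a v w => ContinuousLinearMap.adjoint_inner_right _ _ _
  refine CStarMatrix.ext fun i k => Subtype.ext (ContinuousLinearMap.ext fun v => ?_)
  -- The test vector is column `k` of `P` applied to `v`. There the form of `X` is nonnegative by
  -- hypothesis, yet equals minus the sum of the `‖(W * P) i k v‖ ^ 2`.
  have h1 : ⟪v, ((P * X * P) k k : H →L[ℂ] H) v⟫_ℂ = ∑ i, ∑ j,
      ⟪(P i k : H →L[ℂ] H) v, (X i j : H →L[ℂ] H) ((P j k : H →L[ℂ] H) v)⟫_ℂ := by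
    rw [mul_assoc]
    simp only [CStarMatrix.mul_apply, sum_coe, mul_coe, inner_sum, Finset.mul_sum]
    refine Finset.sum_congr rfl fun i _ => Finset.sum_congr rfl fun j _ => ?_
    rw [← star_coe, hPs]
  generalize W * P = Z at *
  have h2 : ⟪v, ((P * X * P) k k : H →L[ℂ] H) v⟫_ℂ
      = -((∑ i, ‖(Z i k : H →L[ℂ] H) v‖ ^ 2 : ℝ) : ℂ) := by
    have neg_coe : ∀ (a : M), ((-a : M) : H →L[ℂ] H) v = -((a : H →L[ℂ] H) v) := fun a => rfl
    rw [hPX, CStarMatrix.neg_apply, neg_coe, CStarMatrix.mul_apply, inner_neg_right]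
    simp only [sum_coe, mul_coe, inner_sum, CStarMatrix.star_apply, star_coe]
    push_cast
    congr 1
    exact Finset.sum_congr rfl fun i _ => inner_self_eq_norm_sq_to_K (𝕜 := ℂ) _
  have h3 := hX fun i => (P i k : H →L[ℂ] H) v
  rw [← h1, h2, ← Complex.ofReal_neg, Complex.ofReal_re] at h3
  have h4 := (Finset.sum_eq_zero_iff_of_nonneg (fun i _ => sq_nonneg _)).mp
    (le_antisymm (by linarith : ∑ i, ‖(Z i k : H →L[ℂ] H) v‖ ^ 2 ≤ 0)
      (Finset.sum_nonneg fun i _ => sq_nonneg _)) i (Finset.mem_univ i)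
  simpa using h4

/-- A positive element `G` with `G + ε = c²`, `b = c⁻¹`, satisfies `‖b G b‖ ≤ 1`. -/
theorem exists_sqrt_inv {B : Type*} [CStarAlgebra B] [PartialOrder B] [StarOrderedRing B]
    (G : B) (hG : 0 ≤ G) (ε : ℝ) (hε : 0 < ε) :
    ∃ b c : B, star b = b ∧ star c = c ∧ b * c = 1 ∧ c * c = G + (ε : ℂ) • 1 ∧
      ‖b * G * b‖ ≤ 1 := by
  set A : B := G + (ε : ℂ) • 1 with hA
  have hε1 : (ε : ℂ) • (1 : B) = algebraMap ℝ B ε := by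
    rw [Algebra.algebraMap_eq_smul_one, Complex.coe_smul]
  have hεB : (0 : B) ≤ algebraMap ℝ B ε := algebraMap_nonneg B hε.le
  have hA0 : 0 ≤ A := by rw [hA, hε1]; exact add_nonneg hG hεB
  have hAu : IsUnit A := by
    refine CStarAlgebra.isUnit_of_le (algebraMap ℝ B ε)
      (by rw [hA, hε1]; exact le_add_of_nonneg_left hG) ?_
    exact IsStrictlyPositive.iff_of_unital.mpr ⟨hεB, (isUnit_iff_ne_zero.mpr hε.ne').map _⟩
  set c := CFC.sqrt A with hc
  have hcc : c * c = A := CFC.sqrt_mul_sqrt_self A hA0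
  have hcs : star c = c := (IsSelfAdjoint.of_nonneg (CFC.sqrt_nonneg A)).star_eq
  have hcu : IsUnit c := by
    rw [← hcc] at hAu
    exact ((Commute.refl c).isUnit_mul_iff.mp hAu).1
  obtain ⟨u, hu⟩ := hcu
  have hus : star u = u := Units.ext (by rw [Units.coe_star, hu, hcs])
  have hbs : star (↑u⁻¹ : B) = ↑u⁻¹ := by
    rw [← Units.coe_star, star_inv, hus]
  have hbc : (↑u⁻¹ : B) * c = 1 := by rw [← hu, Units.inv_mul]
  have hcb : c * (↑u⁻¹ : B) = 1 := by rw [← hu, Units.mul_inv]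
  refine ⟨↑u⁻¹, c, hbs, hcs, hbc, hcc, ?_⟩
  generalize (↑u⁻¹ : B) = b at *
  have h0 : 0 ≤ b * G * b := by
    simpa only [hbs] using star_left_conjugate_nonneg hG b
  rw [CStarAlgebra.norm_le_one_iff_of_nonneg _ h0]
  have h1 : b * G * b = 1 - ε • (star b * b) := by
    have : G = c * c - (ε : ℂ) • 1 := by rw [hcc, hA, add_sub_cancel_right]
    rw [this, mul_sub, sub_mul, ← mul_assoc, hbc, one_mul, hcb, hbs, mul_smul_comm, mul_one,
      smul_mul_assoc, Complex.coe_smul]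
  rw [h1]
  exact sub_le_self _ (smul_nonneg hε.le (star_mul_self_nonneg b))

end MatrixPositivity

/-! ### Amplifications and the contraction `T̃` on `E ⊗_σ H`. -/

namespace InducedSpace

open HilbertModule

variable {K : Type*} [NormedAddCommGroup K] [InnerProductSpace ℂ K] [CompleteSpace K]
  {N : VonNeumannAlgebra K} {E : Type*} [NormedAddCommGroup E] [NormedSpace ℂ E]

section HilbertModule

variable [HilbertModule N E] {H : Type*} [NormedAddCommGroup H] [InnerProductSpace ℂ H]
  [CompleteSpace H] {F : Type*} [NormedAddCommGroup F] [NormedSpace ℂ F]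
  (σ : N →⋆ₙₐ[ℂ] (H →L[ℂ] H))

theorem inner_ofTensor (u v : E ⊗[ℂ] H) :
    ⟪ofTensor σ u, ofTensor σ v⟫_ℂ = PreInduced.form E σ u v :=
  UniformSpace.Completion.inner_coe (𝕜 := ℂ) (E := PreInduced E σ) _ _

theorem tmul_add (ξ : E) (h k : H) : tmul σ ξ (h + k) = tmul σ ξ h + tmul σ ξ k := by
  simp only [tmul, TensorProduct.tmul_add, map_add]

theorem tmul_smul (c : ℂ) (ξ : E) (h : H) : tmul σ ξ (c • h) = c • tmul σ ξ h := by
  simp only [tmul, TensorProduct.tmul_smul, map_smul]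

theorem sub_tmul (ξ η : E) (h : H) : tmul σ (ξ - η) h = tmul σ ξ h - tmul σ η h := by
  simp only [tmul, TensorProduct.sub_tmul, map_sub]

theorem norm_tmul_sq (ξ : E) (h : H) : ‖tmul σ ξ h‖ ^ 2 = (⟪h, σ (ip ξ ξ) h⟫_ℂ).re := by
  rw [← inner_tmul]
  exact (inner_self_eq_norm_sq (𝕜 := ℂ) _).symm

variable {σ} in
theorem ext {A B : InducedSpace E σ →L[ℂ] F} (h : ∀ ξ v, A (tmul σ ξ v) = B (tmul σ ξ v)) :
    A = B := by
  refine ContinuousLinearMap.ext fun x => ?_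
  refine (denseRange_ofTensor σ).induction_on (p := fun x => A x = B x) x
    (isClosed_eq A.continuous B.continuous) fun u => ?_
  induction u using TensorProduct.induction_on with
  | zero => simp
  | tmul ξ v => exact h ξ v
  | add u v hu hv => rw [map_add, map_add, hu, hv, map_add]

variable {σ} in
theorem ext_inner {x y : InducedSpace E σ} (h : ∀ ξ v, ⟪x, tmul σ ξ v⟫_ℂ = ⟪y, tmul σ ξ v⟫_ℂ) :
    x = y :=
  ext_inner_right ℂ fun z =>
    congrArg (fun A : InducedSpace E σ →L[ℂ] ℂ => A z) (ext (A := innerSL ℂ x) (B := innerSL ℂ y) h)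

/-- The bounded extension to `E ⊗_σ H` of a linear map on the algebraic tensor product. -/
def lift [CompleteSpace F] (f : E ⊗[ℂ] H →ₗ[ℂ] F) : InducedSpace E σ →L[ℂ] F :=
  f.extendOfNorm (ofTensor (E := E) σ)

theorem lift_ofTensor [CompleteSpace F] (f : E ⊗[ℂ] H →ₗ[ℂ] F) (C : ℝ)
    (hf : ∀ u, ‖f u‖ ≤ C * ‖ofTensor σ u‖) (u : E ⊗[ℂ] H) : lift σ f (ofTensor σ u) = f u :=
  LinearMap.extendOfNorm_eq (denseRange_ofTensor σ) ⟨C, hf⟩ u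

theorem ampl_one : ampl (E := E) σ 1 = 1 :=
  ext fun ξ h => by rw [ampl_tmul σ 1 (fun a => by rw [one_mul, mul_one])]; rfl

theorem norm_ampl_le (S : H →L[ℂ] H) (hS : ∀ a, S * σ a = σ a * S) :
    ‖ampl (E := E) σ S‖ ≤ ‖S‖ :=
  LinearMap.opNorm_extendOfNorm_le (denseRange_ofTensor σ) (norm_nonneg S) (ampl_bound σ S hS)

theorem ampl_mul (S R : H →L[ℂ] H) (hS : ∀ a, S * σ a = σ a * S) (hR : ∀ a, R * σ a = σ a * R) :
    ampl (E := E) σ (S * R) = ampl σ S * ampl σ R :=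
  ext fun ξ h => by
    rw [mul_apply_eq_comp, ampl_tmul σ R hR, ampl_tmul σ S hS, ampl_tmul]
    · rfl
    · exact fun a => by rw [mul_assoc, hR, ← mul_assoc, hS, mul_assoc]

theorem ampl_add (S R : H →L[ℂ] H) (hS : ∀ a, S * σ a = σ a * S) (hR : ∀ a, R * σ a = σ a * R) :
    ampl (E := E) σ (S + R) = ampl σ S + ampl σ R :=
  ext fun ξ h => by
    rw [_root_.add_apply, ampl_tmul σ R hR, ampl_tmul σ S hS, ampl_tmul, ← tmul_add]
    · rfl
    · exact fun a => by rw [add_mul, mul_add, hS, hR]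

theorem ampl_smul (c : ℂ) (S : H →L[ℂ] H) (hS : ∀ a, S * σ a = σ a * S) :
    ampl (E := E) σ (c • S) = c • ampl σ S :=
  ext fun ξ h => by
    rw [_root_.smul_apply, ampl_tmul σ S hS, ampl_tmul, ← tmul_smul]
    · rfl
    · exact fun a => by rw [smul_mul_assoc, mul_smul_comm, hS]

theorem star_commute {S : H →L[ℂ] H} (hS : ∀ a, S * σ a = σ a * S) (a : N) :
    star S * σ a = σ a * star S := by
  rw [← star_star (star S * σ a), star_mul, star_star, ← map_star, ← hS, star_mul, ← map_star,
    star_star]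

theorem ampl_star (S : H →L[ℂ] H) (hS : ∀ a, S * σ a = σ a * S) :
    ampl (E := E) σ (star S) = star (ampl σ S) :=
  ext fun ξ h => ext_inner fun η k => by
    rw [ampl_tmul σ _ (star_commute σ hS), ContinuousLinearMap.star_eq_adjoint,
      ContinuousLinearMap.star_eq_adjoint, ContinuousLinearMap.adjoint_inner_left,
      ampl_tmul σ S hS, inner_tmul, inner_tmul, ContinuousLinearMap.adjoint_inner_left]
    exact congrArg (fun A : H →L[ℂ] H => ⟪h, A k⟫_ℂ) (hS _)

variable (E) in
-- For `u = ∑ xᵢ ⊗ hᵢ` with Gram matrix `G`, let `c = (G + ε)^{1/2}`, `b = c⁻¹` and `z = x b`; the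
-- `ε` is there because `G` need not be invertible. The Gram matrix `b G b` of `z` has norm at most
-- 1, so the row `(T zⱼ)` is a contraction. By covariance the image of `u` is `∑ T(zᵢ) kᵢ` with `k =
-- σ(c) h`, and `‖k‖² = ⟨h, σ(G + ε) h⟩` tends to `‖u‖²` as `ε → 0`.
theorem norm_lift_le_of_completelyContractive (T : E →ₗ[ℂ] (H →L[ℂ] H)) (hT : CompletelyContractive N T)
    (hcov : ∀ ξ (a : N), T (rsmul ξ a) = T ξ * σ a) (u : E ⊗[ℂ] H) :
    ‖TensorProduct.lift (ContinuousLinearMap.coeLM ℂ ∘ₗ T) u‖ ≤ 1 * ‖ofTensor σ u‖ := by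
  classical
  rw [one_mul]
  obtain ⟨n, x, h, hu⟩ : ∃ (n : ℕ) (x : Fin n → E) (h : Fin n → H), u = ∑ i, x i ⊗ₜ[ℂ] h i := by
    obtain ⟨s, hs⟩ := TensorProduct.exists_finset u
    refine ⟨s.card, fun i => (s.equivFin.symm i).1.1, fun i => (s.equivFin.symm i).1.2, ?_⟩
    rw [hs, ← Finset.sum_coe_sort, ← s.equivFin.symm.sum_comp]
  have hTu : TensorProduct.lift (ContinuousLinearMap.coeLM ℂ ∘ₗ T) u = ∑ i, T (x i) (h i) := by
    rw [hu, map_sum]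
    rfl
  have hform : PreInduced.form E σ u u = ∑ i, ∑ j, ⟪h i, σ (ip (x i) (x j)) (h j)⟫_ℂ := by
    rw [hu]
    simp only [map_sum, LinearMap.sum_apply, PreInduced.form_tmul]
    exact Finset.sum_comm
  refine le_of_sq_le_sq ?_ (norm_nonneg _)
  rw [hTu, norm_ofTensor_sq, hform]
  obtain ⟨Y, hY⟩ := exists_gram (N := N) x
  obtain ⟨G, hG⟩ : ∃ G : CStarMatrix (Fin n) (Fin n) N, ∀ i j, G i j = ip (x i) (x j) :=
    ⟨CStarMatrix.ofMatrix (Matrix.of fun i j => ip (x i) (x j)), fun i j => rfl⟩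
  have hG0 : 0 ≤ G := by
    have : G = star (CStarMatrix.ofMatrix (Matrix.of Y)) * CStarMatrix.ofMatrix (Matrix.of Y) := by
      ext i j
      rw [hG, hY, CStarMatrix.mul_apply]
      rfl
    rw [this]
    exact star_mul_self_nonneg _
  refine le_of_forall_pos_le_add fun δ hδ => ?_
  -- The summand `ε` of `c * c` costs `ε * M`. As `σ` need not be unital, `σ 1` remains in `M`.
  set M : ℝ := ∑ i, (⟪h i, σ 1 (h i)⟫_ℂ).re with hM
  obtain ⟨ε, hε, hεδ⟩ : ∃ ε : ℝ, 0 < ε ∧ ε * M ≤ δ := by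
    refine ⟨δ / (|M| + 1), by positivity, ?_⟩
    rw [div_mul_eq_mul_div, div_le_iff₀ (by positivity)]
    nlinarith [le_abs_self M]
  obtain ⟨b, c, hb, hc, hbc, hcc, hn⟩ := exists_sqrt_inv G hG0 ε hε
  have hbs : ∀ i j, star (b i j) = b j i := fun i j => by rw [← CStarMatrix.star_apply, hb]
  have hcs : ∀ i j, star (c i j) = c j i := fun i j => by rw [← CStarMatrix.star_apply, hc]
  set z : Fin n → E := fun j => ∑ i, rsmul (x i) (b i j) with hz
  set k : Fin n → H := fun i => ∑ j, σ (c i j) (h j) with hk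
  have hxz : ∀ j, x j = ∑ i, rsmul (z i) (c i j) := fun j => by
    have e : ∀ l, ∑ i, b l i * c i j = if l = j then 1 else 0 := fun l => by
      rw [← CStarMatrix.mul_apply, hbc, CStarMatrix.one_apply]
    simp only [hz, map_sum, LinearMap.sum_apply, ← rsmul_mul]
    rw [Finset.sum_comm]
    simp only [← map_sum, e]
    rw [Finset.sum_eq_single j (fun l _ hl => by simp [hl]) (by simp), if_pos rfl, rsmul_one]
  have hsum : ∑ j, T (x j) (h j) = ∑ i, T (z i) (k i) := by
    have e : ∀ j, T (x j) (h j) = ∑ i, T (z i) (σ (c i j) (h j)) := fun j => by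
      conv_lhs => rw [hxz j]
      simp only [map_sum, hcov, _root_.sum_apply, mul_apply_eq_comp]
    simp only [e, hk, map_sum]
    exact Finset.sum_comm
  have hgram : ∀ i j, (ip (z i) (z j) : N) = (b * G * b) i j := fun i j => by
    simp only [hz, CStarMatrix.mul_apply, map_sum, LinearMap.sum_apply, ip_rsmul, rsmul_ip, hG,
      Finset.sum_mul, hbs]
  have hrow : ‖∑ i, T (z i) (k i)‖ ^ 2 ≤ ∑ i, ‖k i‖ ^ 2 := by
    -- Complete contractivity is about square matrices, so the row becomes row 0 of a matrix whose
    -- other rows vanish; this does not change the Gram matrix. For `n = 0` there is no row 0.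
    rcases n with _ | n
    · simp
    set A : CStarMatrix (Fin (n + 1)) (Fin (n + 1)) (H →L[ℂ] H) :=
      CStarMatrix.ofMatrix (Matrix.of fun i j => T (if i = 0 then z j else 0)) with hA
    have h1 : ‖A‖ ^ 2 ≤ 1 := by
      refine (hT _ _).trans (le_trans (le_of_eq (congrArg _ ?_)) hn)
      refine CStarMatrix.ext fun i j => ?_
      rw [← hgram]
      change ∑ l : Fin (n + 1), (ip (if l = 0 then z i else 0) (if l = 0 then z j else 0) : N) = _
      rw [Finset.sum_eq_single 0 (fun l _ hl => by simp [hl]) (by simp), if_pos rfl, if_pos rfl]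
    have h2 := CStarMatrix.sum_norm_sq_mulVec_le A k
    have h3 : ‖∑ i, T (z i) (k i)‖ ^ 2 = ‖∑ j, A 0 j (k j)‖ ^ 2 := by
      simp [hA]
    rw [h3]
    refine (Finset.single_le_sum (f := fun i => ‖∑ j, A i j (k j)‖ ^ 2)
      (fun i _ => sq_nonneg _) (Finset.mem_univ 0)).trans (h2.trans ?_)
    exact mul_le_of_le_one_left (Finset.sum_nonneg fun i _ => sq_nonneg _) h1
  have hkk : ((∑ i, ‖k i‖ ^ 2 : ℝ) : ℂ)
      = ∑ i, ∑ j, ⟪h i, σ ((c * c) i j) (h j)⟫_ℂ := by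
    push_cast
    have e : ∀ l, ((‖k l‖ : ℂ)) ^ 2 = ∑ i, ∑ j, ⟪h i, σ (c i l * c l j) (h j)⟫_ℂ := fun l => by
      refine (inner_self_eq_norm_sq_to_K (𝕜 := ℂ) (k l)).symm.trans ?_
      simp only [hk, sum_inner, inner_sum]
      rw [Finset.sum_comm]
      refine Finset.sum_congr rfl fun i _ => Finset.sum_congr rfl fun j _ => ?_
      rw [map_mul, mul_apply_eq_comp, ← hcs l i, map_star, ContinuousLinearMap.star_eq_adjoint,
        ContinuousLinearMap.adjoint_inner_right]
    simp only [e, CStarMatrix.mul_apply, map_sum, _root_.sum_apply, inner_sum]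
    rw [Finset.sum_comm]
    exact Finset.sum_congr rfl fun i _ => Finset.sum_comm
  have hsplit : ∑ i, ∑ j, ⟪h i, σ ((c * c) i j) (h j)⟫_ℂ
      = ∑ i, ∑ j, ⟪h i, σ (ip (x i) (x j)) (h j)⟫_ℂ + (ε : ℂ) * ∑ i, ⟪h i, σ 1 (h i)⟫_ℂ := by
    rw [hcc, Finset.mul_sum, ← Finset.sum_add_distrib]
    refine Finset.sum_congr rfl fun i _ => ?_
    simp only [CStarMatrix.add_apply, CStarMatrix.smul_apply, CStarMatrix.one_apply, hG, map_add,
      _root_.add_apply, inner_add_right, Finset.sum_add_distrib]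
    congr 1
    rw [Finset.sum_eq_single i (fun j _ hj => by simp [hj.symm]) (by simp), if_pos rfl, map_smul,
      _root_.smul_apply, inner_smul_right]
  have hre := congrArg Complex.re (hkk.trans hsplit)
  rw [Complex.ofReal_re, Complex.add_re, Complex.re_ofReal_mul,
    Complex.re_sum _ (fun i => ⟪h i, σ 1 (h i)⟫_ℂ)] at hre
  rw [hsum]
  linarith

theorem tilde_tmul (T : E →ₗ[ℂ] (H →L[ℂ] H)) (hT : CompletelyContractive N T)
    (hcov : ∀ ξ (a : N), T (rsmul ξ a) = T ξ * σ a) (ξ : E) (h : H) :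
    tilde σ T (tmul σ ξ h) = T ξ h :=
  LinearMap.extendOfNorm_eq (denseRange_ofTensor σ) ⟨1, norm_lift_le_of_completelyContractive E σ T hT hcov⟩ _

theorem norm_tilde_le (T : E →ₗ[ℂ] (H →L[ℂ] H)) (hT : CompletelyContractive N T)
    (hcov : ∀ ξ (a : N), T (rsmul ξ a) = T ξ * σ a) : ‖tilde σ T‖ ≤ 1 :=
  LinearMap.opNorm_extendOfNorm_le (denseRange_ofTensor σ) zero_le_one
    (norm_lift_le_of_completelyContractive E σ T hT hcov)

end HilbertModule

/-! ### The left action of `N` on `E ⊗_σ H`. -/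

section Correspondence

open CStarCorrespondence

variable [CStarCorrespondence N E] {H : Type*} [NormedAddCommGroup H] [InnerProductSpace ℂ H]
  [CompleteSpace H] (σ : N →⋆ₙₐ[ℂ] (H →L[ℂ] H))

/-- The map `a ⊗ 1` on the algebraic tensor product `E ⊗ H`. -/
def preLeft (a : N) : E ⊗[ℂ] H →ₗ[ℂ] E ⊗[ℂ] H :=
  TensorProduct.map (lsmul a : E →L[ℂ] E).toLinearMap LinearMap.id

theorem form_preLeft (a : N) (u v : E ⊗[ℂ] H) :
    PreInduced.form E σ (preLeft a u) v = PreInduced.form E σ u (preLeft (star a) v) := by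
  induction u using TensorProduct.induction_on with
  | zero => simp
  | add u u' hu hu' => simp only [map_add, LinearMap.add_apply, hu, hu']
  | tmul ξ h =>
    induction v using TensorProduct.induction_on with
    | zero => simp
    | add v v' hv hv' => simp only [map_add, hv, hv']
    | tmul η k =>
      change PreInduced.form E σ (lsmul a ξ ⊗ₜ h) (η ⊗ₜ k)
        = PreInduced.form E σ (ξ ⊗ₜ h) (lsmul (star a) η ⊗ₜ k)
      rw [PreInduced.form_tmul, PreInduced.form_tmul, ip_lsmul]

omit [CompleteSpace H] in
theorem preLeft_mul (a b : N) (u : E ⊗[ℂ] H) : preLeft (a * b) u = preLeft a (preLeft b u) := by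
  have h : (preLeft (a * b) : E ⊗[ℂ] H →ₗ[ℂ] E ⊗[ℂ] H) = preLeft a ∘ₗ preLeft b :=
    TensorProduct.ext' fun ξ v => by
      change lsmul (a * b) ξ ⊗ₜ[ℂ] v = lsmul a (lsmul b ξ) ⊗ₜ[ℂ] v
      rw [map_mul]
      rfl
  rw [h]
  rfl

/-- With `b* b = ‖a‖² - a* a`, one has `‖a‖² ‖u‖² - ‖(a ⊗ 1) u‖² = ‖(b ⊗ 1) u‖² ≥ 0`. Unitality of
the left action is needed for `‖a‖² · 1` to act as the scalar `‖a‖²`. -/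
theorem norm_preLeft_le (h1 : ∀ ξ : E, lsmul (1 : N) ξ = ξ) (a : N) (u : E ⊗[ℂ] H) :
    ‖ofTensor σ (preLeft a u)‖ ≤ ‖a‖ * ‖ofTensor σ u‖ := by
  obtain ⟨b, hb⟩ := exists_norm_sq_sub_star_mul_self a
  have e1 : ∀ c : N, ‖ofTensor σ (preLeft c u)‖ ^ 2
      = (PreInduced.form E σ u (preLeft (star c * c) u)).re := fun c => by
    rw [norm_ofTensor_sq, form_preLeft, preLeft_mul]
  have e2 : (preLeft (star b * b) u : E ⊗[ℂ] H)
      = ((‖a‖ ^ 2 : ℝ) : ℂ) • u - preLeft (star a * a) u := by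
    rw [← hb]
    have h1' : (lsmul (1 : N) : E →L[ℂ] E) = 1 := ContinuousLinearMap.ext h1
    have : (preLeft (((‖a‖ ^ 2 : ℝ) : ℂ) • (1 : N) - star a * a) : E ⊗[ℂ] H →ₗ[ℂ] E ⊗[ℂ] H)
        = ((‖a‖ ^ 2 : ℝ) : ℂ) • LinearMap.id - preLeft (star a * a) := by
      refine TensorProduct.ext' fun ξ h => ?_
      change lsmul (((‖a‖ ^ 2 : ℝ) : ℂ) • (1 : N) - star a * a) ξ ⊗ₜ[ℂ] h
        = ((‖a‖ ^ 2 : ℝ) : ℂ) • (ξ ⊗ₜ[ℂ] h) - lsmul (star a * a) ξ ⊗ₜ[ℂ] h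
      rw [map_sub, map_smul, h1', _root_.sub_apply, TensorProduct.sub_tmul]
      rfl
    rw [this]
    rfl
  have e3 := e1 b
  rw [e2, map_sub, map_smul, Complex.sub_re, smul_eq_mul, Complex.re_ofReal_mul,
    ← norm_ofTensor_sq, ← e1 a] at e3
  refine le_of_sq_le_sq ?_ (by positivity)
  rw [mul_pow]
  linarith [sq_nonneg ‖ofTensor σ (preLeft b u)‖]

/-- The operator `a ⊗ 1` on `E ⊗_σ H`. -/
def left (a : N) : InducedSpace E σ →L[ℂ] InducedSpace E σ := lift σ (ofTensor σ ∘ₗ preLeft a)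

theorem left_tmul (h1 : ∀ ξ : E, lsmul (1 : N) ξ = ξ) (a : N) (ξ : E) (h : H) :
    left σ a (tmul σ ξ h) = tmul σ (lsmul a ξ) h :=
  lift_ofTensor σ (ofTensor σ ∘ₗ preLeft a) ‖a‖ (norm_preLeft_le σ h1 a) _

theorem star_left (h1 : ∀ ξ : E, lsmul (1 : N) ξ = ξ) (a : N) :
    star (left (E := E) σ a) = left σ (star a) :=
  ext fun ξ h => ext_inner fun η k => by
    rw [ContinuousLinearMap.star_eq_adjoint, ContinuousLinearMap.adjoint_inner_left,
      left_tmul σ h1, left_tmul σ h1, inner_tmul, inner_tmul, ip_lsmul, star_star]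

theorem left_ampl_comm (h1 : ∀ ξ : E, lsmul (1 : N) ξ = ξ) (a : N) (S : H →L[ℂ] H)
    (hS : ∀ a, S * σ a = σ a * S) :
    left (E := E) σ a * ampl σ S = ampl σ S * left σ a :=
  ext fun ξ h => by
    rw [mul_apply_eq_comp, mul_apply_eq_comp, ampl_tmul σ S hS, left_tmul σ h1, left_tmul σ h1,
      ampl_tmul σ S hS]

end Correspondence

end InducedSpace

/-! ### Countable vector pairings and the `σ`-weak topology. -/

section SigmaWeak

variable {H : Type*} [NormedAddCommGroup H] [InnerProductSpace ℂ H]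

/-- Rescaling a pairing by vectors with `∑ ‖aᵢ‖ ‖bᵢ‖ < ∞` to square summable families. -/
theorem exists_sq_summable_rescale {ι : Type*} (a b : ι → H)
    (h : Summable fun i => ‖a i‖ * ‖b i‖) :
    ∃ a' b' : ι → H, (Summable fun i => ‖a' i‖ ^ 2) ∧ (Summable fun i => ‖b' i‖ ^ 2) ∧
      ∀ (x : H →L[ℂ] H) i, ⟪a' i, x (b' i)⟫_ℂ = ⟪a i, x (b i)⟫_ℂ := by
  have key : ∀ i, ∃ v w : H, ‖v‖ ^ 2 = ‖a i‖ * ‖b i‖ ∧ ‖w‖ ^ 2 = ‖a i‖ * ‖b i‖ ∧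
      ∀ x : H →L[ℂ] H, ⟪v, x w⟫_ℂ = ⟪a i, x (b i)⟫_ℂ := fun i => by
    by_cases ha : a i = 0
    · exact ⟨0, 0, by simp [ha], by simp [ha], by simp [ha]⟩
    by_cases hb : b i = 0
    · exact ⟨0, 0, by simp [hb], by simp [hb], by simp [hb]⟩
    have hp : 0 < ‖a i‖ := norm_pos_iff.mpr ha
    have hq : 0 < ‖b i‖ := norm_pos_iff.mpr hb
    set c : ℝ := √(‖b i‖ / ‖a i‖) with hc
    have hc0 : 0 < c := Real.sqrt_pos.mpr (by positivity)
    have hc2 : c ^ 2 = ‖b i‖ / ‖a i‖ := Real.sq_sqrt (by positivity)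
    refine ⟨(c : ℂ) • a i, ((c⁻¹ : ℝ) : ℂ) • b i, ?_, ?_, fun x => ?_⟩
    · rw [norm_smul, mul_pow, Complex.norm_real, Real.norm_eq_abs, sq_abs, hc2]
      field_simp
    · rw [norm_smul, mul_pow, Complex.norm_real, Real.norm_eq_abs, sq_abs, inv_pow, hc2]
      field_simp
    · rw [map_smul, inner_smul_left, inner_smul_right, Complex.conj_ofReal, ← mul_assoc,
        ← Complex.ofReal_mul, mul_inv_cancel₀ hc0.ne', Complex.ofReal_one, one_mul]
  choose v w hv hw hvw using key
  exact ⟨v, w, by simpa only [hv] using h, by simpa only [hw] using h, fun x i => hvw i x⟩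

/-- Pairings by countable families with `∑ ‖aᵢ‖ ‖bᵢ‖ < ∞` are `σ`-weakly continuous. -/
theorem continuous_tsum_inner_sigmaWeak {ι : Type*} [Countable ι] (a b : ι → H)
    (h : Summable fun i => ‖a i‖ * ‖b i‖) :
    @Continuous _ _ (sigmaWeakTopology H) inferInstance
      fun x : H →L[ℂ] H => ∑' i, ⟪a i, x (b i)⟫_ℂ := by
  obtain ⟨a', b', ha, hb, hab⟩ := exists_sq_summable_rescale a b h
  obtain ⟨f, hf⟩ := exists_injective_nat ι
  have hsum : ∀ c : ι → H, (Summable fun i => ‖c i‖ ^ 2) →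
      Summable fun n => ‖Function.extend f c 0 n‖ ^ 2 := fun c hc => by
    refine (hf.summable_iff fun n hn => ?_).mp ?_
    · rw [Function.extend_apply' _ _ _ hn]
      simp
    · simpa only [Function.comp_def, hf.extend_apply] using hc
  have e : ∀ x : H →L[ℂ] H, ∑' n, ⟪Function.extend f a' 0 n, x (Function.extend f b' 0 n)⟫_ℂ
      = ∑' i, ⟪a i, x (b i)⟫_ℂ := fun x => by
    rw [← hf.tsum_eq]
    · simp only [hf.extend_apply, hab]
    · intro n hn
      by_contra hn'
      exact hn (by simp only [Function.extend_apply' _ _ _ hn', Pi.zero_apply, inner_zero_left])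
  simp only [← e]
  exact continuous_iInf_dom (i := Function.extend f a' 0) <|
    continuous_iInf_dom (i := Function.extend f b' 0) <|
    continuous_iInf_dom (i := hsum a' ha) <| continuous_iInf_dom (i := hsum b' hb)
      continuous_induced_dom

/-- On the set `s` of operators, the functional `f` is a pairing `∑ ⟪aᵢ, · bᵢ⟫` with
`∑ ‖aᵢ‖ ‖bᵢ‖ ≤ C`. -/
def HasPairing (s : Set (H →L[ℂ] H)) (f : (H →L[ℂ] H) → ℂ) (C : ℝ) : Prop :=
  ∃ (ι : Type) (_ : Countable ι) (a b : ι → H), (Summable fun i => ‖a i‖ * ‖b i‖) ∧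
    ∑' i, ‖a i‖ * ‖b i‖ ≤ C ∧ ∀ x ∈ s, HasSum (fun i => ⟪a i, x (b i)⟫_ℂ) (f x)

/-- The families are concatenated over the sigma type, which is why pairings may have any countable
index type. The bounds `C j` are carried along because their summability makes the concatenated
family absolutely summable. -/
theorem HasPairing.hasSum {s : Set (H →L[ℂ] H)} {J : Type} [Countable J]
    {f : J → (H →L[ℂ] H) → ℂ} {g : (H →L[ℂ] H) → ℂ} {C : J → ℝ}
    (hf : ∀ j, HasPairing s (f j) (C j)) (hC : Summable C)
    (hg : ∀ x ∈ s, HasSum (fun j => f j x) (g x)) : HasPairing s g (∑' j, C j) := by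
  choose ι hι a b hsum hle hx using hf
  have hn : Summable fun p : Σ j, ι j => ‖a p.1 p.2‖ * ‖b p.1 p.2‖ :=
    (summable_sigma_of_nonneg fun p => by positivity).mpr ⟨hsum,
      Summable.of_nonneg_of_le (fun j => tsum_nonneg fun i => by positivity) hle hC⟩
  refine ⟨Σ j, ι j, inferInstance, fun p => a p.1 p.2, fun p => b p.1 p.2, hn, ?_, fun x hxs => ?_⟩
  · rw [hn.tsum_sigma' hsum]
    exact Summable.tsum_le_tsum hle
      (Summable.of_nonneg_of_le (fun j => tsum_nonneg fun i => by positivity) hle hC) hC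
  · have hs : Summable fun p : Σ j, ι j => ⟪a p.1 p.2, x (b p.1 p.2)⟫_ℂ := by
      refine Summable.of_norm_bounded (hn.mul_left ‖x‖) fun p => ?_
      refine (norm_inner_le_norm _ _).trans ?_
      rw [mul_left_comm]
      gcongr
      exact x.le_opNorm _
    rw [(hg x hxs).unique (hs.hasSum.sigma fun j => hx j x hxs)]
    exact hs.hasSum

theorem HasPairing.continuous [CompleteSpace H] {M : VonNeumannAlgebra H}
    {f : (H →L[ℂ] H) → ℂ} {C : ℝ} (hf : HasPairing (M : Set (H →L[ℂ] H)) f C) :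
    @Continuous _ _ M.sigmaWeak inferInstance fun x : M => f x := by
  obtain ⟨ι, _, a, b, hsum, -, hx⟩ := hf
  have : (fun x : M => f x)
      = (fun x : H →L[ℂ] H => ∑' i, ⟪a i, x (b i)⟫_ℂ) ∘ fun x : M => (x : H →L[ℂ] H) :=
    funext fun x => (hx x x.2).tsum_eq.symm
  rw [this]
  exact @Continuous.comp _ _ _ M.sigmaWeak (sigmaWeakTopology H) _ _ _
    (continuous_tsum_inner_sigmaWeak a b hsum) continuous_induced_dom

theorem hasSum_inner_prod {G : Type*} [NormedAddCommGroup G] [InnerProductSpace ℂ G]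
    {ι κ : Type*} {x : ι → G} {y : κ → G} {u v : G} (hx : HasSum x u) (hy : HasSum y v)
    (hprod : Summable fun p : ι × κ => ‖x p.1‖ * ‖y p.2‖) (A : G →L[ℂ] G) :
    HasSum (fun p : ι × κ => ⟪x p.1, A (y p.2)⟫_ℂ) ⟪u, A v⟫_ℂ := by
  have hs : Summable fun p : ι × κ => ⟪x p.1, A (y p.2)⟫_ℂ := by
    refine Summable.of_norm_bounded (hprod.mul_left ‖A‖) fun p => ?_
    refine (norm_inner_le_norm _ _).trans ?_
    rw [mul_left_comm]
    gcongr
    exact A.le_opNorm _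
  have h1 : ∀ w : G, HasSum (fun j => ⟪w, A (y j)⟫_ℂ) ⟪w, A v⟫_ℂ :=
    fun w => (innerSL ℂ w ∘L A).hasSum hy
  have h2 : HasSum (fun i => ⟪x i, A v⟫_ℂ) ⟪u, A v⟫_ℂ := by
    have := ((innerSL ℂ (A v)).hasSum hx).star
    simpa [innerSL_apply_apply] using this
  rw [h2.unique (hs.hasSum.prod_fiberwise fun i => h1 _)]
  exact hs.hasSum

end SigmaWeak

/-! ### Normality of the amplification. -/

namespace InducedSpace

open HilbertModule

variable {K : Type*} [NormedAddCommGroup K] [InnerProductSpace ℂ K] [CompleteSpace K]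
  {N : VonNeumannAlgebra K} {E : Type*} [NormedAddCommGroup E] [NormedSpace ℂ E]
  [HilbertModule N E] {H : Type*} [NormedAddCommGroup H] [InnerProductSpace ℂ H]
  [CompleteSpace H] (σ : N →⋆ₙₐ[ℂ] (H →L[ℂ] H))

/-- Write `u = ∑ Xᵢ ⊗ pᵢ` and `v = ∑ Xᵢ ⊗ qᵢ` and factor the Gram matrix of `X` as `Y* Y`. Since `S`
commutes with `σ(Y)`, the vectors `w = σ(Y) p` and `z = σ(Y) q` do the job, and `S = 1` gives the
norms. -/
theorem exists_sum_inner (u v : E ⊗[ℂ] H) : ∃ (ι : Type) (_ : Fintype ι) (w z : ι → H),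
    ∑ l, ‖w l‖ ^ 2 = ‖ofTensor σ u‖ ^ 2 ∧ ∑ l, ‖z l‖ ^ 2 = ‖ofTensor σ v‖ ^ 2 ∧
    ∀ S : H →L[ℂ] H, (∀ a, S * σ a = σ a * S) →
      ⟪ofTensor σ u, ampl σ S (ofTensor σ v)⟫_ℂ = ∑ l, ⟪w l, S (z l)⟫_ℂ := by
  classical
  have ex : ∀ u : E ⊗[ℂ] H, ∃ (n : ℕ) (x : Fin n → E) (h : Fin n → H),
      u = ∑ i, x i ⊗ₜ[ℂ] h i := fun u => by
    obtain ⟨s, hs⟩ := TensorProduct.exists_finset u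
    refine ⟨s.card, fun i => (s.equivFin.symm i).1.1, fun i => (s.equivFin.symm i).1.2, ?_⟩
    rw [hs, ← Finset.sum_coe_sort, ← s.equivFin.symm.sum_comp]
  obtain ⟨n, x, h, hu⟩ := ex u
  obtain ⟨m, y, k, hv⟩ := ex v
  -- Padding with zeros gives `u` and `v` the same vectors of `E`, so that one Gram factorisation
  -- serves both.
  obtain ⟨X, p, q, hu', hv'⟩ : ∃ (X : Fin n ⊕ Fin m → E) (p q : Fin n ⊕ Fin m → H),
      u = ∑ i, X i ⊗ₜ[ℂ] p i ∧ v = ∑ i, X i ⊗ₜ[ℂ] q i :=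
    ⟨Sum.elim x y, Sum.elim h 0, Sum.elim 0 k, by simp [hu], by simp [hv]⟩
  obtain ⟨Y, hY⟩ := exists_gram (N := N) X
  have key : ∀ (p q : Fin n ⊕ Fin m → H) (S : H →L[ℂ] H), (∀ a, S * σ a = σ a * S) →
      ⟪ofTensor σ (∑ i, X i ⊗ₜ[ℂ] p i), ampl σ S (ofTensor σ (∑ i, X i ⊗ₜ[ℂ] q i))⟫_ℂ
        = ∑ l, ⟪∑ i, σ (Y l i) (p i), S (∑ j, σ (Y l j) (q j))⟫_ℂ := fun p q S hS => by
    have hS' : ∀ a v, S (σ a v) = σ a (S v) := fun a v =>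
      congrArg (fun A : H →L[ℂ] H => A v) (hS a)
    have e1 : ampl σ S (ofTensor σ (∑ i, X i ⊗ₜ[ℂ] q i)) = ofTensor σ (∑ i, X i ⊗ₜ[ℂ] S (q i)) := by
      rw [map_sum, map_sum, map_sum]
      exact Finset.sum_congr rfl fun i _ => ampl_tmul σ S hS (X i) (q i)
    rw [e1, inner_ofTensor]
    simp only [map_sum, LinearMap.sum_apply, PreInduced.form_tmul, hY, _root_.sum_apply,
      inner_sum, sum_inner, hS', map_mul, mul_apply_eq_comp, map_star,
      ContinuousLinearMap.star_eq_adjoint, ContinuousLinearMap.adjoint_inner_right]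
    refine (Finset.sum_congr rfl fun i _ => Finset.sum_comm).trans ?_
    exact Finset.sum_comm
  have hnorm : ∀ p : Fin n ⊕ Fin m → H, ∑ l, ‖∑ i, σ (Y l i) (p i)‖ ^ 2
      = ‖ofTensor σ (∑ i, X i ⊗ₜ[ℂ] p i)‖ ^ 2 := fun p => by
    have h1 := key p p 1 fun a => by rw [one_mul, mul_one]
    rw [ampl_one] at h1
    have h2 := congrArg Complex.re h1
    rw [Complex.re_sum] at h2
    refine Eq.trans ?_ (h2.symm.trans (inner_self_eq_norm_sq (𝕜 := ℂ) _))
    exact Finset.sum_congr rfl fun l _ => (inner_self_eq_norm_sq (𝕜 := ℂ) _).symm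
  refine ⟨Fin n ⊕ Fin m, inferInstance, fun l => ∑ i, σ (Y l i) (p i),
    fun l => ∑ i, σ (Y l i) (q i), ?_, ?_, fun S hS => ?_⟩
  · rw [hu', hnorm]
  · rw [hv', hnorm]
  · rw [hu', hv', key p q S hS]

theorem hasPairing_ofTensor (u v : E ⊗[ℂ] H) :
    HasPairing {S : H →L[ℂ] H | ∀ a, S * σ a = σ a * S}
      (fun S => ⟪ofTensor σ u, ampl σ S (ofTensor σ v)⟫_ℂ) (‖ofTensor σ u‖ * ‖ofTensor σ v‖) := by
  obtain ⟨ι, _, w, z, hw, hz, h⟩ := exists_sum_inner σ u v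
  refine ⟨ι, inferInstance, w, z, Summable.of_finite, ?_, fun S hS => ?_⟩
  · rw [tsum_fintype]
    refine le_of_sq_le_sq ?_ (by positivity)
    rw [mul_pow, ← hw, ← hz]
    exact Finset.sum_mul_sq_le_sq_mul_sq _ _ _
  · change HasSum _ ⟪ofTensor σ u, ampl σ S (ofTensor σ v)⟫_ℂ
    rw [h S hS]
    exact hasSum_fintype _

theorem exists_hasSum_ofTensor (u : InducedSpace E σ) (ε : ℝ) (hε : 0 < ε) :
    ∃ x : ℕ → E ⊗[ℂ] H, HasSum (fun n => ofTensor σ (x n)) u ∧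
      (Summable fun n => ‖ofTensor σ (x n)‖) ∧ ∑' n, ‖ofTensor σ (x n)‖ ≤ ‖u‖ + ε := by
  have hu : u ∈ closure ((LinearMap.range (ofTensor (E := E) σ)).toAddSubgroup :
      Set (InducedSpace E σ)) := denseRange_ofTensor σ u
  have hb : HasSum (fun n : ℕ => ε / 2 / 2 / 2 ^ n) (ε / 2) := hasSum_geometric_two' (ε / 2)
  obtain ⟨v, hv, hvr, hv0, hvn⟩ := controlled_sum_of_mem_closure hu
    (b := fun n => ε / 2 / 2 / 2 ^ n) (fun n => by positivity)
  choose x hx using hvr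
  -- The term of index 0 is only known to be close to `u`, hence the extra `‖u‖` there. The
  -- geometric bounds add up to `ε / 2`.
  have hbd : ∀ n, ‖ofTensor σ (x n)‖ ≤ Pi.single (M := fun _ => ℝ) 0 ‖u‖ n + ε / 2 / 2 / 2 ^ n :=
    fun n => by
    rw [hx]
    rcases Nat.eq_zero_or_pos n with rfl | hn
    · rw [Pi.single_eq_same]
      have : v 0 = u - (-v 0 + u) := by abel
      rw [this]
      exact (norm_sub_le _ _).trans (add_le_add le_rfl hv0.le)
    · rw [Pi.single_eq_of_ne hn.ne', zero_add]
      exact (hvn n hn).le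
  have hs := (hasSum_pi_single (0 : ℕ) ‖u‖).add hb
  have hsum : Summable fun n => ‖ofTensor σ (x n)‖ :=
    Summable.of_nonneg_of_le (fun n => norm_nonneg _) hbd hs.summable
  refine ⟨x, ?_, hsum, ?_⟩
  · have h1 := hsum.of_norm.hasSum
    have h2 := (h1.tendsto_sum_nat.comp (Filter.tendsto_add_atTop_nat 1))
    simp only [← hx] at hv
    rwa [tendsto_nhds_unique hv h2]
  · refine (hsum.tsum_le_tsum hbd hs.summable).trans ?_
    rw [hs.tsum_eq]
    linarith

/-- Both vectors are expanded into absolutely convergent series of algebraic tensors. The explicit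
constant is what later allows summation over sequences of vectors. -/
theorem hasPairing_ampl (u v : InducedSpace E σ) (ε : ℝ) (hε : 0 < ε) :
    HasPairing {S : H →L[ℂ] H | ∀ a, S * σ a = σ a * S}
      (fun S => ⟪u, ampl σ S v⟫_ℂ) ((‖u‖ + ε) * (‖v‖ + ε)) := by
  obtain ⟨x, hx, hxs, hxle⟩ := exists_hasSum_ofTensor σ u ε hε
  obtain ⟨y, hy, hys, hyle⟩ := exists_hasSum_ofTensor σ v ε hε
  have hprod := hxs.mul_of_nonneg hys (fun _ => norm_nonneg _) (fun _ => norm_nonneg _)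
  have h := HasPairing.hasSum (fun p : ℕ × ℕ => hasPairing_ofTensor σ (x p.1) (y p.2)) hprod
    (g := fun S => ⟪u, ampl σ S v⟫_ℂ) (fun S _ => hasSum_inner_prod hx hy hprod (ampl σ S))
  obtain ⟨ι, hι, a, b, hab, hle, hS⟩ := h
  refine ⟨ι, hι, a, b, hab, hle.trans ?_, hS⟩
  refine (hxs.tsum_mul_tsum hys hprod).symm.trans_le ?_
  exact mul_le_mul hxle hyle (tsum_nonneg fun _ => norm_nonneg _) (by positivity)

/-- The amplification `S ↦ 1 ⊗ S`, compressed by an operator, is a normal map of `σ(N)'`. -/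
theorem continuous_compression_ampl (V : InducedSpace E σ →L[ℂ] H)
    (Φ : repCommutant σ → repCommutant σ)
    (hΦ : ∀ S, (Φ S : H →L[ℂ] H) = V ∘L ampl σ S ∘L ContinuousLinearMap.adjoint V) :
    @Continuous _ _ (repCommutant σ).sigmaWeak (repCommutant σ).sigmaWeak Φ := by
  refine continuous_induced_rng.mpr ?_
  refine continuous_iInf_rng.mpr fun a => continuous_iInf_rng.mpr fun b =>
    continuous_iInf_rng.mpr fun ha => continuous_iInf_rng.mpr fun hb =>
    continuous_induced_rng.mpr ?_
  set W := ContinuousLinearMap.adjoint V with hW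
  have hsq : ∀ c : ℕ → H, (Summable fun n => ‖c n‖ ^ 2) → Summable fun n => ‖W (c n)‖ ^ 2 :=
    fun c hc => Summable.of_nonneg_of_le (fun n => sq_nonneg _)
      (fun n => by
        rw [← mul_pow]
        exact pow_le_pow_left₀ (norm_nonneg _) (W.le_opNorm _) 2) (hc.mul_left (‖W‖ ^ 2))
  -- The `n`-th pair of vectors gets the tolerance `(1 / 2) ^ n`; square summability of these keeps
  -- the bounds from `hasPairing_ampl` summable.
  have hgeo : Summable fun n : ℕ => ((1 / 2 : ℝ) ^ n) ^ 2 := by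
    simp only [pow_right_comm _ _ 2]
    exact summable_geometric_of_lt_one (by norm_num) (by norm_num)
  have hmaj : Summable fun n =>
      (‖W (a n)‖ + (1 / 2 : ℝ) ^ n) * (‖W (b n)‖ + (1 / 2 : ℝ) ^ n) := by
    refine Summable.of_nonneg_of_le (fun n => by positivity) (fun n => ?_)
      (((hsq a ha).add (hsq b hb)).add (hgeo.add hgeo))
    nlinarith [sq_nonneg (‖W (a n)‖ - ‖W (b n)‖), sq_nonneg (‖W (a n)‖ - (1 / 2 : ℝ) ^ n),
      sq_nonneg (‖W (b n)‖ - (1 / 2 : ℝ) ^ n)]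
  have hs : ∀ S : H →L[ℂ] H, Summable fun n => ⟪W (a n), ampl σ S (W (b n))⟫_ℂ := fun S => by
    refine Summable.of_norm_bounded (hmaj.mul_left ‖ampl (E := E) σ S‖) fun n => ?_
    refine (norm_inner_le_norm _ _).trans ?_
    calc ‖W (a n)‖ * ‖ampl σ S (W (b n))‖ ≤ ‖W (a n)‖ * (‖ampl (E := E) σ S‖ * ‖W (b n)‖) := by
          gcongr
          exact (ampl σ S).le_opNorm _
      _ = ‖ampl (E := E) σ S‖ * (‖W (a n)‖ * ‖W (b n)‖) := by ring
      _ ≤ _ := by gcongr <;> exact le_add_of_nonneg_right (by positivity)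
  have h := HasPairing.hasSum (fun n => hasPairing_ampl σ (W (a n)) (W (b n)) ((1 / 2) ^ n)
    (by positivity)) hmaj (g := fun S => ∑' n, ⟪W (a n), ampl σ S (W (b n))⟫_ℂ)
    fun S _ => (hs S).hasSum
  obtain ⟨C, h'⟩ : ∃ C, HasPairing (repCommutant σ : Set (H →L[ℂ] H))
      (fun S => ∑' n, ⟪W (a n), ampl σ S (W (b n))⟫_ℂ) C := by
    obtain ⟨ι, hι, p, q, hpq, hle, hS⟩ := h
    exact ⟨_, ι, hι, p, q, hpq, hle, fun S hSm => hS S ((mem_repCommutant σ).mp hSm)⟩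
  refine Eq.mp (congrArg _ (funext fun S => tsum_congr fun n => ?_)) h'.continuous
  change _ = ⟪a n, (Φ S : H →L[ℂ] H) (b n)⟫_ℂ
  rw [hΦ]
  exact ContinuousLinearMap.adjoint_inner_left _ _ _

end InducedSpace

/-! ### Self-duality and `σ`-strongly dense subsets. -/

theorem norm_sq_le_norm_sum_star_mul_self {B : Type*} [CStarAlgebra B] {ι : Type*} [Fintype ι]
    (Y : ι → B) (k : ι) : ‖Y k‖ ^ 2 ≤ ‖∑ i, star (Y i) * Y i‖ := by
  let _ := CStarAlgebra.spectralOrder B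
  have _ := CStarAlgebra.spectralOrderedRing B
  rw [sq, ← CStarRing.norm_star_mul_self]
  exact CStarAlgebra.norm_le_norm_of_nonneg_of_le (star_mul_self_nonneg _)
    (Finset.single_le_sum (f := fun k => star (Y k) * Y k)
      (fun k _ => star_mul_self_nonneg _) (Finset.mem_univ k))

namespace HilbertModule

open CStarCorrespondence

variable {K : Type*} [NormedAddCommGroup K] [InnerProductSpace ℂ K] [CompleteSpace K]
  {N : VonNeumannAlgebra K}

section

variable {E : Type*} [NormedAddCommGroup E] [NormedSpace ℂ E] [HilbertModule N E]

variable (N) in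
theorem exists_ip_self_eq (ξ : E) : ∃ Y : N, (ip ξ ξ : N) = star Y * Y := by
  obtain ⟨Y, hY⟩ := exists_gram (N := N) fun _ : Unit => ξ
  exact ⟨Y () (), by simpa using hY () ()⟩

theorem inner_star_mul_self (Y : N) (v w : K) :
    ⟪v, ((star Y * Y : N) : K →L[ℂ] K) w⟫_ℂ = ⟪(Y : K →L[ℂ] K) v, (Y : K →L[ℂ] K) w⟫_ℂ :=
  ContinuousLinearMap.adjoint_inner_right (Y : K →L[ℂ] K) v _

theorem re_inner_star_mul_self (Y : N) (v : K) :
    (⟪v, ((star Y * Y : N) : K →L[ℂ] K) v⟫_ℂ).re = ‖(Y : K →L[ℂ] K) v‖ ^ 2 := by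
  rw [inner_star_mul_self]
  exact inner_self_eq_norm_sq (𝕜 := ℂ) _

variable (N) in
-- A crude Cauchy–Schwarz inequality: the Gram factorisation of the pair gives two terms, each at
-- most `‖ξ‖ ‖η‖`. Only boundedness of `⟨ξ, ·⟩` is needed, in order to apply self-duality.
theorem norm_ip_le (ξ η : E) : ‖(ip ξ η : N)‖ ≤ 2 * ‖ξ‖ * ‖η‖ := by
  obtain ⟨Y, hY⟩ := exists_gram (N := N) ![ξ, η]
  have hn : ∀ k i, ‖Y k i‖ ≤ ‖![ξ, η] i‖ := fun k i => by
    refine le_of_sq_le_sq ?_ (norm_nonneg _)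
    rw [norm_sq_eq (N := N) (![ξ, η] i), hY]
    exact norm_sq_le_norm_sum_star_mul_self (fun k => Y k i) k
  have h := hY 0 1
  simp only [Matrix.cons_val_zero, Matrix.cons_val_one] at h
  have hk : ∀ k, ‖star (Y k 0) * Y k 1‖ ≤ ‖ξ‖ * ‖η‖ := fun k => by
    refine (norm_mul_le _ _).trans ?_
    rw [norm_star]
    exact mul_le_mul (hn k 0) (hn k 1) (norm_nonneg _) (norm_nonneg _)
  rw [h, Fin.sum_univ_two]
  refine (norm_add_le _ _).trans ?_
  linarith [hk 0, hk 1]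

/-- A vector orthogonal to a `σ`-strongly dense set is zero. -/
theorem eq_zero_of_sigmaStronglyDense {S : Set E} (hS : SigmaStronglyDense N S) (ω : E)
    (h : ∀ η ∈ S, (ip ω η : N) = 0) : ω = 0 := by
  obtain ⟨Y, hY⟩ := exists_ip_self_eq N ω
  suffices hY0 : Y = 0 by
    have h1 := norm_sq_eq (N := N) ω
    rw [hY, hY0, mul_zero, norm_zero] at h1
    exact norm_eq_zero.mp (pow_eq_zero_iff two_ne_zero |>.mp h1)
  refine Subtype.ext (ContinuousLinearMap.ext fun v => ?_)
  suffices hv : ‖(Y : K →L[ℂ] K) v‖ ^ 2 ≤ 0 by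
    simpa using le_antisymm hv (sq_nonneg _)
  refine le_of_forall_pos_lt_add fun ε hε => ?_
  have ha : Summable fun n => ‖(Pi.single 0 v : ℕ → K) n‖ ^ 2 :=
    summable_of_ne_finset_zero (s := {0}) fun n hn => by
      rw [Pi.single_eq_of_ne (by simpa using hn)]
      simp
  obtain ⟨η, hη, hlt⟩ := hS ω (Pi.single 0 v) ha ε hε
  rw [tsum_eq_single 0 fun n hn => by rw [Pi.single_eq_of_ne hn]; simp, Pi.single_eq_same] at hlt
  obtain ⟨Z, hZ⟩ := exists_ip_self_eq N η
  have h2 : (ip η ω : N) = 0 := by rw [← star_ip, h η hη, star_zero]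
  -- Pythagoras: as `η` is orthogonal to `ω`, approximating `ω` by `η` leaves an error of at least
  -- `⟨ω, ω⟩`.
  have h3 : (ip (ω - η) (ω - η) : N) = star Y * Y + star Z * Z := by
    rw [map_sub, map_sub, LinearMap.sub_apply, LinearMap.sub_apply, h η hη, h2, hY, hZ]
    abel
  have h4 : (⟪v, ((star Y * Y + star Z * Z : N) : K →L[ℂ] K) v⟫_ℂ).re
      = ‖(Y : K →L[ℂ] K) v‖ ^ 2 + ‖(Z : K →L[ℂ] K) v‖ ^ 2 := by
    rw [← re_inner_star_mul_self, ← re_inner_star_mul_self, ← Complex.add_re, ← inner_add_right]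
    rfl
  rw [h3, h4] at hlt
  linarith [sq_nonneg ‖(Z : K →L[ℂ] K) v‖]

end

/-- An inner product preserving module map of a self-dual module with `σ`-strongly dense range is
surjective. -/
theorem surjective_of_sigmaStronglyDense {F G : Type*} [NormedAddCommGroup F] [NormedSpace ℂ F]
    [NormedAddCommGroup G] [NormedSpace ℂ G] [WStarCorrespondence N F] [HilbertModule N G]
    (V : F →ₗ[ℂ] G) (hV : ∀ ξ η, (ip (V ξ) (V η) : N) = ip ξ η)
    (hmod : ∀ ξ (a : N), V (rsmul ξ a) = rsmul (V ξ) a)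
    (hd : SigmaStronglyDense N (Set.range V)) : Function.Surjective V := by
  intro ζ
  have hnorm : ∀ ξ, ‖V ξ‖ = ‖ξ‖ := fun ξ => by
    rw [← sq_eq_sq₀ (norm_nonneg _) (norm_nonneg _), norm_sq_eq (N := N), hV, ← norm_sq_eq]
  -- Self-duality represents `ξ ↦ ⟨ζ, V ξ⟩` by some `ζ'`, and then `ζ - V ζ'` is orthogonal to the
  -- dense range.
  obtain ⟨ζ', hζ'⟩ := WStarCorrespondence.self_dual (N := N)
    (((ip ζ : G →ₗ[ℂ] N) ∘ₗ V).mkContinuous (2 * ‖ζ‖) fun ξ =>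
      (norm_ip_le N ζ (V ξ)).trans_eq (by rw [hnorm]))
    fun ξ a => by
      change (ip ζ (V (rsmul ξ a)) : N) = ip ζ (V ξ) * a
      rw [hmod, ip_rsmul]
  refine ⟨ζ', (sub_eq_zero.mp (eq_zero_of_sigmaStronglyDense hd (ζ - V ζ') ?_)).symm⟩
  rintro _ ⟨ξ, rfl⟩
  have : (ip ζ (V ξ) : N) = ip ζ' ξ := hζ' ξ
  rw [map_sub, LinearMap.sub_apply, hV, this, sub_self]

end HilbertModule

/-! ### The fibre at time zero as a unit. -/

namespace DiscreteProductSystem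

open HilbertModule CStarCorrespondence

variable {K : Type*} [NormedAddCommGroup K] [InnerProductSpace ℂ K] [CompleteSpace K]
  {N : VonNeumannAlgebra K} {E : ℝ≥0 → Type*} [∀ t, NormedAddCommGroup (E t)]
  [∀ t, NormedSpace ℂ (E t)] [∀ t, WStarCorrespondence N (E t)] (P : DiscreteProductSystem N E)

include P in
-- Unitality of the left action is not an axiom of a correspondence; here `E(0) ⊗ E(t) ≃ E(0 + t)`
-- forces it. The unit fixes every tensor `b ⊗ η`, so `ζ - 1 · ζ` is orthogonal to a `σ`-strongly
-- dense set.
theorem lsmul_one (t : ℝ≥0) (ξ : E t) : lsmul (1 : N) ξ = ξ := by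
  have aux : ∀ ζ : E (0 + t), lsmul (1 : N) ζ = ζ := fun ζ => by
    refine (sub_eq_zero.mp (eq_zero_of_sigmaStronglyDense (P.isTensor 0 t).dense
      (ζ - lsmul (1 : N) ζ) fun s hs => ?_)).symm
    have hfix : lsmul (1 : N) s = s := by
      induction hs using Submodule.span_induction with
      | mem x hx =>
        obtain ⟨⟨x, η⟩, rfl⟩ := hx
        obtain ⟨b, rfl⟩ := P.unit.surjective x
        change lsmul (1 : N) (P.mul 0 t (P.unit b) η) = P.mul 0 t (P.unit b) η
        rw [← (P.isTensor 0 t).map_lsmul, P.lsmul_unit, one_mul]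
      | zero => exact map_zero _
      | add x y _ _ hx hy => rw [map_add, hx, hy]
      | smul c x _ hx => rw [map_smul, hx]
    rw [map_sub, LinearMap.sub_apply, ip_lsmul, star_one, hfix, sub_self]
  rw [zero_add] at aux
  exact aux ξ

/-- Since `ξ ⊗ a = ξ a ⊗ 1`, the range of the inner product preserving map `ξ ↦ ξ ⊗ 1` is already
the span of all tensors, and self-duality of `E(t)` applies. The axioms do not say that `ξ ⊗ a` is
`ξ a` under `E(t + 0) = E(t)`; surjectivity is a substitute for that. -/
theorem surjective_mul_unit (t : ℝ≥0) :
    Function.Surjective fun ξ : E t => P.mul t 0 ξ (P.unit 1) := by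
  have h := P.isTensor t 0
  have hmul : ∀ (ξ : E t) a, P.mul t 0 ξ (P.unit a) = P.mul t 0 (rsmul ξ a) (P.unit 1) :=
    fun ξ a => by rw [h.balanced, P.lsmul_unit, mul_one]
  refine surjective_of_sigmaStronglyDense (N := N) ((P.mul t 0).flip (P.unit 1))
    (fun ξ η => ?_) (fun ξ a => ?_) ?_
  · change (ip (P.mul t 0 ξ (P.unit 1)) (P.mul t 0 η (P.unit 1)) : N) = ip ξ η
    rw [h.ip_map, P.lsmul_unit, P.ip_unit, star_one, one_mul, mul_one]
  · change P.mul t 0 (rsmul ξ a) (P.unit 1) = rsmul (P.mul t 0 ξ (P.unit 1)) a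
    rw [← hmul, ← h.map_rsmul, P.rsmul_unit, one_mul]
  · convert h.dense
    rw [← LinearMap.coe_range, SetLike.coe_set_eq]
    refine le_antisymm ?_ (Submodule.span_le.mpr ?_)
    · rintro _ ⟨ξ, rfl⟩
      exact Submodule.subset_span ⟨(ξ, P.unit 1), rfl⟩
    · rintro _ ⟨⟨ξ, x⟩, rfl⟩
      obtain ⟨a, rfl⟩ := P.unit.surjective x
      exact ⟨rsmul ξ a, (hmul ξ a).symm⟩

theorem surjective_unit_mul (t : ℝ≥0) :
    Function.Surjective fun ξ : E t => P.mul 0 t (P.unit 1) ξ := by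
  have h := P.isTensor 0 t
  have hmul : ∀ (ξ : E t) a, P.mul 0 t (P.unit a) ξ = P.mul 0 t (P.unit 1) (lsmul a ξ) :=
    fun ξ a => by rw [← h.balanced, P.rsmul_unit, one_mul]
  refine surjective_of_sigmaStronglyDense (N := N) (P.mul 0 t (P.unit 1))
    (fun ξ η => ?_) (fun ξ a => ?_) ?_
  · rw [h.ip_map, P.ip_unit, star_one, one_mul, P.lsmul_one]
  · rw [h.map_rsmul]
  · convert h.dense
    rw [← LinearMap.coe_range, SetLike.coe_set_eq]
    refine le_antisymm ?_ (Submodule.span_le.mpr ?_)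
    · rintro _ ⟨ξ, rfl⟩
      exact Submodule.subset_span ⟨(P.unit 1, ξ), rfl⟩
    · rintro _ ⟨⟨x, ξ⟩, rfl⟩
      obtain ⟨a, rfl⟩ := P.unit.surjective x
      exact ⟨lsmul a ξ, (hmul ξ a).symm⟩

end DiscreteProductSystem

/-! ### Covariance of `Tₜ` and normality of `T₀`. -/

namespace CovariantRep

open HilbertModule CStarCorrespondence

variable {K : Type*} [NormedAddCommGroup K] [InnerProductSpace ℂ K] [CompleteSpace K]
  {N : VonNeumannAlgebra K} {E : ℝ≥0 → Type*} [∀ t, NormedAddCommGroup (E t)]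
  [∀ t, NormedSpace ℂ (E t)] [∀ t, WStarCorrespondence N (E t)] {P : DiscreteProductSystem N E}
  {H : Type*} [NormedAddCommGroup H] [InnerProductSpace ℂ H] [CompleteSpace H]
  (R : CovariantRep P H)

/-- On `ξ ⊗ 1` multiplicativity gives `T((ξ ⊗ 1) a) = T(ξ ⊗ a) = T(ξ) σ(a) = T(ξ ⊗ 1) σ(a)`, and
these vectors exhaust `E(t + 0)`. -/
theorem T_rsmul (t : ℝ≥0) (ξ : E t) (a : N) : R.T t (rsmul ξ a) = R.T t ξ * R.σ a := by
  have aux : ∀ ζ : E (t + 0), R.T (t + 0) (rsmul ζ a) = R.T (t + 0) ζ * R.σ a := fun ζ => by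
    obtain ⟨ξ, rfl⟩ := P.surjective_mul_unit t ζ
    have h : ∀ b : N, R.T (t + 0) (P.mul t 0 ξ (P.unit b)) = R.T t ξ * R.σ b :=
      fun b => R.map_mul t 0 ξ (P.unit b)
    change R.T (t + 0) (rsmul (P.mul t 0 ξ (P.unit 1)) a)
      = R.T (t + 0) (P.mul t 0 ξ (P.unit 1)) * R.σ a
    rw [← (P.isTensor t 0).map_rsmul, P.rsmul_unit, one_mul, h, h, mul_assoc, ← _root_.map_mul, one_mul]
  rw [add_zero] at aux
  exact aux ξ

theorem T_lsmul (t : ℝ≥0) (ξ : E t) (a : N) : R.T t (lsmul a ξ) = R.σ a * R.T t ξ := by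
  have aux : ∀ ζ : E (0 + t), R.T (0 + t) (lsmul a ζ) = R.σ a * R.T (0 + t) ζ := fun ζ => by
    obtain ⟨ξ, rfl⟩ := P.surjective_unit_mul t ζ
    have h : ∀ b : N, R.T (0 + t) (P.mul 0 t (P.unit b) ξ) = R.σ b * R.T t ξ :=
      fun b => R.map_mul 0 t (P.unit b) ξ
    change R.T (0 + t) (lsmul a (P.mul 0 t (P.unit 1) ξ))
      = R.σ a * R.T (0 + t) (P.mul 0 t (P.unit 1) ξ)
    rw [← (P.isTensor 0 t).map_lsmul, P.lsmul_unit, mul_one, h, h, ← mul_assoc, ← _root_.map_mul, mul_one]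
  rw [zero_add] at aux
  exact aux ξ

theorem norm_unit (P : DiscreteProductSystem N E) (a : N) : ‖P.unit a‖ = ‖a‖ := by
  rw [← sq_eq_sq₀ (norm_nonneg _) (norm_nonneg _), norm_sq_eq (N := N), P.ip_unit,
    CStarRing.norm_star_mul_self, sq]

/-- On `E(0) = N` a functional of the `σ`-topology is `∑ ⟪aₙ, yₙ* x bₙ⟫ = ∑ ⟪yₙ aₙ, x bₙ⟫`, a
`σ`-weak pairing. -/
theorem continuous_unit (P : DiscreteProductSystem N E) :
    @Continuous _ _ N.sigmaWeak (sigmaTopology N (E 0)) P.unit := by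
  refine continuous_iInf_rng.mpr fun η => continuous_iInf_rng.mpr fun a =>
    continuous_iInf_rng.mpr fun b => continuous_iInf_rng.mpr fun h =>
    continuous_induced_rng.mpr ?_
  obtain ⟨y, rfl⟩ : ∃ y : ℕ → N, (fun n => P.unit (y n)) = η :=
    ⟨fun n => P.unit.symm (η n), by simp⟩
  have hs : Summable fun n => ‖(y n : K →L[ℂ] K) (a n)‖ * ‖b n‖ := by
    refine Summable.of_nonneg_of_le (fun n => by positivity) (fun n => ?_) h
    rw [norm_unit, mul_comm ‖a n‖]
    exact mul_le_mul_of_nonneg_right ((y n : K →L[ℂ] K).le_opNorm _) (norm_nonneg _)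
  refine Eq.mp (congrArg _ (funext fun x => tsum_congr fun n => ?_))
    (@Continuous.comp _ _ _ N.sigmaWeak (sigmaWeakTopology K) _ _ _
      (continuous_tsum_inner_sigmaWeak _ b hs) continuous_induced_dom)
  rw [P.ip_unit]
  exact (ContinuousLinearMap.adjoint_inner_right (y n : K →L[ℂ] K) (a n) _).symm

theorem continuous_σ : @Continuous _ _ N.sigmaWeak (sigmaWeakTopology H) R.σ :=
  @Continuous.comp _ _ _ N.sigmaWeak (sigmaTopology N (E 0)) (sigmaWeakTopology H) _ _
    (R.continuous 0) (continuous_unit P)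

end CovariantRep

/-! ### From `σ`-strong density in `E` to norm density in `E ⊗_σ H`. -/

namespace InducedSpace

open HilbertModule Filter

variable {K : Type*} [NormedAddCommGroup K] [InnerProductSpace ℂ K] [CompleteSpace K]
  {N : VonNeumannAlgebra K} {E : Type*} [NormedAddCommGroup E] [NormedSpace ℂ E]
  [HilbertModule N E] {H : Type*} [NormedAddCommGroup H] [InnerProductSpace ℂ H]
  [CompleteSpace H] (σ : N →⋆ₙₐ[ℂ] (H →L[ℂ] H))

omit [CompleteSpace K] in
theorem summable_re_inner (x : K →L[ℂ] K) (c : ℕ → K) (hc : Summable fun n => ‖c n‖ ^ 2) :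
    Summable fun n => (⟪c n, x (c n)⟫_ℂ).re := by
  refine Summable.of_norm_bounded (hc.mul_left ‖x‖) fun n => ?_
  refine (Complex.abs_re_le_norm _).trans ((norm_inner_le_norm _ _).trans ?_)
  rw [sq, mul_left_comm]
  gcongr
  exact x.le_opNorm _

omit [CompleteSpace K] in
-- This makes the functionals `∑ ⟪cₙ, · cₙ⟫` a directed family, so that their approximation sets
-- generate a proper filter.
theorem exists_interleave (c d : ℕ → K) (hc : Summable fun n => ‖c n‖ ^ 2)
    (hd : Summable fun n => ‖d n‖ ^ 2) : ∃ e : ℕ → K, (Summable fun n => ‖e n‖ ^ 2) ∧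
      ∀ x : K →L[ℂ] K, ∑' n, (⟪e n, x (e n)⟫_ℂ).re
        = ∑' n, (⟪c n, x (c n)⟫_ℂ).re + ∑' n, (⟪d n, x (d n)⟫_ℂ).re := by
  have hsplit : ∀ g : K → ℝ, (Summable fun n => g (c n)) → (Summable fun n => g (d n)) →
      HasSum (fun n => g (Sum.elim c d (Equiv.natSumNatEquivNat.symm n)))
        (∑' n, g (c n) + ∑' n, g (d n)) := fun g h1 h2 => by
    have hcd : HasSum (fun i : ℕ ⊕ ℕ => g (Sum.elim c d i)) (∑' n, g (c n) + ∑' n, g (d n)) :=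
      HasSum.sum (f := fun i : ℕ ⊕ ℕ => g (Sum.elim c d i)) h1.hasSum h2.hasSum
    exact (Equiv.hasSum_iff (f := fun i : ℕ ⊕ ℕ => g (Sum.elim c d i))
      Equiv.natSumNatEquivNat.symm).mpr hcd
  exact ⟨fun n => Sum.elim c d (Equiv.natSumNatEquivNat.symm n),
    (hsplit (fun v => ‖v‖ ^ 2) hc hd).summable, fun x =>
    (hsplit (fun v => (⟪v, x v⟫_ℂ).re) (summable_re_inner x c hc) (summable_re_inner x d hd)).tsum_eq⟩

/-- Termwise `|⟪Y a, Y b⟫| ≤ (‖Y a‖² + ‖Y b‖²) / 2`. Hence smallness of `⟨ζ, ζ⟩` on the diagonal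
functionals gives `σ`-weak smallness. -/
theorem norm_tsum_inner_le (Y : N) (a b : ℕ → K) (ha : Summable fun n => ‖a n‖ ^ 2)
    (hb : Summable fun n => ‖b n‖ ^ 2) :
    ‖∑' n, ⟪a n, ((star Y * Y : N) : K →L[ℂ] K) (b n)⟫_ℂ‖
      ≤ (∑' n, (⟪a n, ((star Y * Y : N) : K →L[ℂ] K) (a n)⟫_ℂ).re
        + ∑' n, (⟪b n, ((star Y * Y : N) : K →L[ℂ] K) (b n)⟫_ℂ).re) / 2 := by
  have sa := summable_re_inner ((star Y * Y : N) : K →L[ℂ] K) a ha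
  have sb := summable_re_inner ((star Y * Y : N) : K →L[ℂ] K) b hb
  rw [← sa.tsum_add sb, ← tsum_div_const]
  refine tsum_of_norm_bounded ((sa.add sb).div_const 2).hasSum fun n => ?_
  rw [re_inner_star_mul_self, re_inner_star_mul_self, inner_star_mul_self]
  refine (norm_inner_le_norm _ _).trans ?_
  nlinarith [sq_nonneg (‖(Y : K →L[ℂ] K) (a n)‖ - ‖(Y : K →L[ℂ] K) (b n)‖)]

/-- The positive functional `∑ ⟪cₙ, · cₙ⟫` at `⟨ζ, ζ⟩`. -/
def sqSeminorm (N : VonNeumannAlgebra K) {E : Type*} [NormedAddCommGroup E] [NormedSpace ℂ E]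
    [HilbertModule N E] (c : ℕ → K) (ζ : E) : ℝ :=
  ∑' n, (⟪c n, (ip ζ ζ : N).1 (c n)⟫_ℂ).re

variable (N) in
theorem sqSeminorm_nonneg (c : ℕ → K) (ζ : E) : 0 ≤ sqSeminorm N c ζ := by
  obtain ⟨Y, hY⟩ := exists_ip_self_eq N ζ
  refine tsum_nonneg fun n => ?_
  rw [hY, re_inner_star_mul_self]
  exact sq_nonneg _

variable (N) in
theorem exists_filter_sqSeminorm {S : Set E} (hS : SigmaStronglyDense N S) (ζ : E) :
    ∃ l : Filter E, l.NeBot ∧ S ∈ l ∧ ∀ c : ℕ → K, (Summable fun n => ‖c n‖ ^ 2) →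
      ∀ ε : ℝ, 0 < ε → ∀ᶠ η in l, sqSeminorm N c (ζ - η) < ε := by
  let I := {c : ℕ → K // Summable fun n => ‖c n‖ ^ 2} × {ε : ℝ // 0 < ε}
  let f : I → Set E := fun p => {η | η ∈ S ∧ sqSeminorm N p.1.1 (ζ - η) < p.2.1}
  have i0 : I := ⟨⟨0, by simp⟩, ⟨1, one_pos⟩⟩
  have : Nonempty I := ⟨i0⟩
  refine ⟨⨅ p : I, 𝓟 (f p), iInf_neBot_of_directed' ?_ fun p => ?_,
    mem_iInf_of_mem i0 (mem_principal.mpr fun η hη => hη.1), fun c hc ε hε =>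
    mem_iInf_of_mem (⟨⟨c, hc⟩, ⟨ε, hε⟩⟩ : I) (mem_principal.mpr fun η hη => And.right hη)⟩
  · intro p p'
    obtain ⟨e, he, hsplit⟩ := exists_interleave p.1.1 p'.1.1 p.1.2 p'.1.2
    refine ⟨⟨⟨e, he⟩, ⟨min p.2.1 p'.2.1, lt_min p.2.2 p'.2.2⟩⟩,
      principal_mono.mpr fun η hη => ⟨hη.1, ?_⟩, principal_mono.mpr fun η hη => ⟨hη.1, ?_⟩⟩
    all_goals
      have h1 : sqSeminorm N e (ζ - η) < min p.2.1 p'.2.1 := hη.2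
      have h2 : sqSeminorm N e (ζ - η) = sqSeminorm N p.1.1 (ζ - η) + sqSeminorm N p'.1.1 (ζ - η) :=
        hsplit _
      have h3 := sqSeminorm_nonneg N p.1.1 (ζ - η)
      have h4 := sqSeminorm_nonneg N p'.1.1 (ζ - η)
      have h5 := lt_min_iff.mp h1
    · linarith [h5.1]
    · linarith [h5.2]
  · obtain ⟨η, hη, hlt⟩ := hS ζ p.1.1 p.1.2 p.2.1 p.2.2
    exact principal_neBot_iff.mpr ⟨η, hη, hlt⟩

variable (N) in
/-- The elements of a `σ`-strongly dense set that approximate `ζ` form a filter along which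
`⟨ζ - η, ζ - η⟩` tends `σ`-weakly to zero. -/
theorem exists_filter_of_sigmaStronglyDense {S : Set E} (hS : SigmaStronglyDense N S) (ζ : E) :
    ∃ l : Filter E, l.NeBot ∧ S ∈ l ∧
      @Tendsto E N (fun η => ip (ζ - η) (ζ - η)) l (@nhds N N.sigmaWeak 0) := by
  obtain ⟨l, hl, hSl, hev⟩ := exists_filter_sqSeminorm N hS ζ
  refine ⟨l, hl, hSl, ?_⟩
  rw [@nhds_induced _ _ (sigmaWeakTopology K), tendsto_comap_iff]
  simp only [nhds_iInf, tendsto_iInf]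
  intro a b ha hb
  rw [nhds_induced, tendsto_comap_iff]
  simp only [ZeroMemClass.coe_zero, _root_.zero_apply, inner_zero_right, tsum_zero]
  refine Metric.tendsto_nhds.mpr fun ε hε => ?_
  filter_upwards [hev a ha ε hε, hev b hb ε hε] with η h1 h2
  rw [dist_zero_right]
  change ‖∑' n, ⟪a n, (ip (ζ - η) (ζ - η) : N).1 (b n)⟫_ℂ‖ < ε
  obtain ⟨Y, hY⟩ := exists_ip_self_eq N (ζ - η)
  rw [sqSeminorm, hY] at h1 h2
  rw [hY]
  refine (norm_tsum_inner_le Y a b ha hb).trans_lt ?_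
  linarith

/-- `‖(ζ - η) ⊗ h‖² = ⟪h, σ(⟨ζ - η, ζ - η⟩) h⟫` tends to zero as `η → ζ` `σ`-strongly, by normality
of `σ`. -/
theorem tmul_mem_closure (hσ : @Continuous _ _ N.sigmaWeak (sigmaWeakTopology H) σ) {S : Set E}
    (hS : SigmaStronglyDense N S) (ζ : E) (h : H) :
    tmul σ ζ h ∈ closure ((fun η => tmul σ η h) '' S) := by
  obtain ⟨l, hl, hSl, ht⟩ := exists_filter_of_sigmaStronglyDense N hS ζ
  have hfun : @Continuous _ _ (sigmaWeakTopology H) inferInstance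
      fun x : H →L[ℂ] H => ∑' _ : Unit, ⟪h, x h⟫_ℂ :=
    continuous_tsum_inner_sigmaWeak (fun _ : Unit => h) (fun _ => h) Summable.of_finite
  have h1 := (@Continuous.tendsto _ _ N.sigmaWeak _ _
    (@Continuous.comp _ _ _ N.sigmaWeak (sigmaWeakTopology H) _ _ _ hfun hσ) 0).comp ht
  have h2 : Tendsto (fun η => ‖tmul σ η h - tmul σ ζ h‖ ^ 2) l (nhds 0) := by
    have h3 := (Complex.continuous_re.tendsto _).comp h1
    simp only [Function.comp_def, tsum_fintype, Finset.univ_unique, Finset.sum_singleton, map_zero,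
      _root_.zero_apply, inner_zero_right, Complex.zero_re] at h3
    refine h3.congr fun η => ?_
    rw [← norm_tmul_sq, sub_tmul, norm_sub_rev]
  have h4 : Tendsto (fun η => tmul σ η h) l (nhds (tmul σ ζ h)) := by
    rw [tendsto_iff_norm_sub_tendsto_zero]
    have := (Real.continuous_sqrt.tendsto 0).comp h2
    simpa only [Function.comp_def, Real.sqrt_sq (norm_nonneg _), Real.sqrt_zero] using this
  exact mem_closure_of_tendsto h4 (mem_of_superset hSl fun η hη => ⟨η, hη, rfl⟩)

end InducedSpace

/-! ### Creation operators and the space `E ⊗ F ⊗_σ H`. -/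

namespace InducedSpace

open HilbertModule CStarCorrespondence

variable {K : Type*} [NormedAddCommGroup K] [InnerProductSpace ℂ K] [CompleteSpace K]
  {N : VonNeumannAlgebra K} {E F G : Type*} [NormedAddCommGroup E] [NormedSpace ℂ E]
  [NormedAddCommGroup F] [NormedSpace ℂ F] [NormedAddCommGroup G] [NormedSpace ℂ G]
  [WStarCorrespondence N E] [WStarCorrespondence N F] [WStarCorrespondence N G]
  {H : Type*} [NormedAddCommGroup H] [InnerProductSpace ℂ H] [CompleteSpace H]
  (σ : N →⋆ₙₐ[ℂ] (H →L[ℂ] H)) {m : E →ₗ[ℂ] F →ₗ[ℂ] G}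

theorem form_map_mul (hm : IsCorrespondenceTensor N m) (ξ ξ' : E) (u v : F ⊗[ℂ] H) :
    PreInduced.form G σ (TensorProduct.map (m ξ) LinearMap.id u)
      (TensorProduct.map (m ξ') LinearMap.id v)
      = PreInduced.form F σ u (preLeft (ip ξ ξ' : N) v) := by
  induction u using TensorProduct.induction_on with
  | zero => simp
  | add u u' hu hu' => simp only [map_add, LinearMap.add_apply, hu, hu']
  | tmul η h =>
    induction v using TensorProduct.induction_on with
    | zero => simp
    | add v v' hv hv' => simp only [map_add, hv, hv']
    | tmul η' k =>
      change PreInduced.form G σ (m ξ η ⊗ₜ h) (m ξ' η' ⊗ₜ k)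
        = PreInduced.form F σ (η ⊗ₜ h) (lsmul (ip ξ ξ' : N) η' ⊗ₜ k)
      rw [PreInduced.form_tmul, PreInduced.form_tmul, hm.ip_map]

theorem norm_map_mul_le (hm : IsCorrespondenceTensor N m) (h1 : ∀ η : F, lsmul (1 : N) η = η)
    (ξ : E) (u : F ⊗[ℂ] H) :
    ‖ofTensor σ (TensorProduct.map (m ξ) LinearMap.id u)‖ ≤ ‖ξ‖ * ‖ofTensor σ u‖ := by
  refine le_of_sq_le_sq ?_ (by positivity)
  rw [norm_ofTensor_sq, form_map_mul σ hm, ← inner_ofTensor, mul_pow, norm_sq_eq (N := N) ξ]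
  refine (Complex.re_le_norm _).trans ((norm_inner_le_norm _ _).trans ?_)
  calc ‖ofTensor σ u‖ * ‖ofTensor σ (preLeft (ip ξ ξ : N) u)‖
      ≤ ‖ofTensor σ u‖ * (‖(ip ξ ξ : N)‖ * ‖ofTensor σ u‖) := by
        gcongr
        exact norm_preLeft_le σ h1 _ u
    _ = _ := by ring

variable (m) in
/-- The operator `η ⊗ h ↦ (ξ ⊗ η) ⊗ h`. -/
def creation (ξ : E) : InducedSpace F σ →L[ℂ] InducedSpace G σ :=
  lift σ (ofTensor σ ∘ₗ TensorProduct.map (m ξ) LinearMap.id)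

theorem creation_tmul (hm : IsCorrespondenceTensor N m) (h1 : ∀ η : F, lsmul (1 : N) η = η)
    (ξ : E) (η : F) (h : H) : creation σ m ξ (tmul σ η h) = tmul σ (m ξ η) h :=
  lift_ofTensor σ (ofTensor σ ∘ₗ TensorProduct.map (m ξ) LinearMap.id) ‖ξ‖
    (norm_map_mul_le σ hm h1 ξ) _

theorem add_tmul (ξ η : E) (h : H) : tmul σ (ξ + η) h = tmul σ ξ h + tmul σ η h := by
  simp only [tmul, TensorProduct.add_tmul, map_add]

theorem smul_tmul (c : ℂ) (ξ : E) (h : H) : tmul σ (c • ξ) h = c • tmul σ ξ h := by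
  rw [tmul, tmul, ← TensorProduct.smul_tmul', map_smul]

theorem creation_add (hm : IsCorrespondenceTensor N m) (h1 : ∀ η : F, lsmul (1 : N) η = η)
    (ξ ξ' : E) : creation σ m (ξ + ξ') = creation (H := H) σ m ξ + creation σ m ξ' :=
  ext fun η h => by
    rw [_root_.add_apply, creation_tmul σ hm h1, creation_tmul σ hm h1, creation_tmul σ hm h1,
      map_add, LinearMap.add_apply, add_tmul]

theorem creation_smul (hm : IsCorrespondenceTensor N m) (h1 : ∀ η : F, lsmul (1 : N) η = η)
    (c : ℂ) (ξ : E) : creation σ m (c • ξ) = c • creation (H := H) σ m ξ :=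
  ext fun η h => by
    rw [_root_.smul_apply, creation_tmul σ hm h1, creation_tmul σ hm h1, map_smul,
      LinearMap.smul_apply, smul_tmul]

theorem inner_creation (hm : IsCorrespondenceTensor N m) (h1 : ∀ η : F, lsmul (1 : N) η = η)
    (ξ ξ' : E) (x y : InducedSpace F σ) :
    ⟪creation σ m ξ x, creation σ m ξ' y⟫_ℂ = ⟪x, left σ (ip ξ ξ' : N) y⟫_ℂ := by
  have h : ContinuousLinearMap.adjoint (creation (H := H) σ m ξ') ∘L creation σ m ξ
      = left σ (star (ip ξ ξ') : N) :=
    ext fun η h => ext_inner fun η' k => by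
      rw [ContinuousLinearMap.comp_apply, ContinuousLinearMap.adjoint_inner_left,
        creation_tmul σ hm h1, creation_tmul σ hm h1, left_tmul σ h1, inner_tmul, inner_tmul,
        hm.ip_map, ip_lsmul, star_star]
  rw [← ContinuousLinearMap.adjoint_inner_left, ← ContinuousLinearMap.comp_apply, h,
    ← star_left σ h1, ContinuousLinearMap.star_eq_adjoint, ContinuousLinearMap.adjoint_inner_left]

theorem ampl_creation (hm : IsCorrespondenceTensor N m) (h1 : ∀ η : F, lsmul (1 : N) η = η)
    (S : H →L[ℂ] H) (hS : ∀ a, S * σ a = σ a * S) (ξ : E) (x : InducedSpace F σ) :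
    ampl σ S (creation σ m ξ x) = creation σ m ξ (ampl σ S x) := by
  have h : ampl σ S ∘L creation (H := H) σ m ξ = creation σ m ξ ∘L ampl σ S :=
    ext fun η h => by
      rw [ContinuousLinearMap.comp_apply, ContinuousLinearMap.comp_apply, creation_tmul σ hm h1,
        ampl_tmul σ S hS, ampl_tmul σ S hS, creation_tmul σ hm h1]
  exact congrArg (fun A : InducedSpace F σ →L[ℂ] InducedSpace G σ => A x) h

/-- For an operator `X : H → F ⊗_σ H` that intertwines `σ` with the left action, the operator
`ξ ⊗ h ↦ ξ ⊗ X h` from `E ⊗_σ H` to `E ⊗ F ⊗_σ H`. -/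
theorem exists_amplify (hm : IsCorrespondenceTensor N m) (h1 : ∀ η : F, lsmul (1 : N) η = η)
    (X : H →L[ℂ] InducedSpace F σ) (hX : ∀ a h, left σ a (X h) = X (σ a h)) :
    ∃ V : InducedSpace E σ →L[ℂ] InducedSpace G σ,
      ∀ ξ h, V (tmul σ ξ h) = creation σ m ξ (X h) := by
  let f : E ⊗[ℂ] H →ₗ[ℂ] InducedSpace G σ := TensorProduct.lift
    (LinearMap.mk₂ ℂ (fun ξ h => creation σ m ξ (X h))
      (fun ξ ξ' h => by rw [creation_add σ hm h1, _root_.add_apply])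
      (fun c ξ h => by rw [creation_smul σ hm h1, _root_.smul_apply])
      (fun ξ h h' => by rw [map_add, map_add])
      (fun c ξ h => by rw [map_smul, map_smul]))
  have hf : ∀ ξ h, f (ξ ⊗ₜ h) = creation σ m ξ (X h) := fun ξ h => rfl
  -- `Q = X* X` commutes with `σ(N)` and `⟨f u, f v⟩ = ⟨u, (1 ⊗ Q) v⟩`, so boundedness of `f`
  -- follows from that of `1 ⊗ Q`.
  set Q : H →L[ℂ] H := ContinuousLinearMap.adjoint X ∘L X with hQ
  have hadj : ∀ a y, ContinuousLinearMap.adjoint X (left σ a y)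
      = σ a (ContinuousLinearMap.adjoint X y) := fun a y => ext_inner_right ℂ fun h => by
    rw [ContinuousLinearMap.adjoint_inner_left, ← ContinuousLinearMap.adjoint_inner_right,
      ← ContinuousLinearMap.star_eq_adjoint, star_left σ h1, hX,
      ← ContinuousLinearMap.adjoint_inner_left, map_star, ContinuousLinearMap.star_eq_adjoint,
      ContinuousLinearMap.adjoint_inner_right]
  have hQc : ∀ a, Q * σ a = σ a * Q := fun a => ContinuousLinearMap.ext fun h => by
    change ContinuousLinearMap.adjoint X (X (σ a h)) = σ a (ContinuousLinearMap.adjoint X (X h))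
    rw [← hX, hadj]
  have hinner : ∀ u v, ⟪f u, f v⟫_ℂ = ⟪ofTensor σ u, ampl σ Q (ofTensor σ v)⟫_ℂ := fun u v => by
    induction u using TensorProduct.induction_on with
    | zero => simp
    | add u u' hu hu' => simp only [map_add, inner_add_left, hu, hu']
    | tmul ξ h =>
      induction v using TensorProduct.induction_on with
      | zero => simp
      | add v v' hv hv' => simp only [map_add, inner_add_right, hv, hv']
      | tmul ξ' h' =>
        change _ = ⟪tmul σ ξ h, ampl σ Q (tmul σ ξ' h')⟫_ℂ
        rw [hf, hf, inner_creation σ hm h1, ampl_tmul σ Q hQc, inner_tmul,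
          ← ContinuousLinearMap.adjoint_inner_right, hadj]
        rfl
  -- The natural constant is the square root of `‖1 ⊗ Q‖`; `q ≤ (q + 1) ^ 2` avoids the root.
  have hbd : ∀ u, ‖f u‖ ≤ (‖ampl (E := E) σ Q‖ + 1) * ‖ofTensor σ u‖ := fun u => by
    refine le_of_sq_le_sq ?_ (by positivity)
    have e : ‖f u‖ ^ 2 = (⟪f u, f u⟫_ℂ).re := (inner_self_eq_norm_sq (𝕜 := ℂ) _).symm
    rw [e, hinner]
    refine (Complex.re_le_norm _).trans ((norm_inner_le_norm _ _).trans ?_)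
    calc ‖ofTensor σ u‖ * ‖ampl σ Q (ofTensor σ u)‖
        ≤ ‖ofTensor σ u‖ * (‖ampl (E := E) σ Q‖ * ‖ofTensor σ u‖) := by
          gcongr
          exact (ampl σ Q).le_opNorm _
      _ = ‖ampl (E := E) σ Q‖ * ‖ofTensor σ u‖ ^ 2 := by ring
      _ ≤ (‖ampl (E := E) σ Q‖ + 1) ^ 2 * ‖ofTensor σ u‖ ^ 2 := by
          gcongr
          nlinarith [norm_nonneg (ampl (E := E) σ Q)]
      _ = _ := by ring
  exact ⟨lift σ f, fun ξ h => lift_ofTensor σ f _ hbd _⟩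

/-- Identifies `V*` with `1 ⊗ X*`. For `X = T̃ₜ*` this is `1 ⊗ T̃ₜ`. -/
theorem adjoint_amplify_creation (hm : IsCorrespondenceTensor N m)
    (h1 : ∀ η : F, lsmul (1 : N) η = η) (X : H →L[ℂ] InducedSpace F σ)
    (hX : ∀ a h, left σ a (X h) = X (σ a h)) (V : InducedSpace E σ →L[ℂ] InducedSpace G σ)
    (hV : ∀ ξ h, V (tmul σ ξ h) = creation σ m ξ (X h)) (ξ : E) (x : InducedSpace F σ) :
    ContinuousLinearMap.adjoint V (creation σ m ξ x)
      = tmul σ ξ (ContinuousLinearMap.adjoint X x) := ext_inner fun ξ' h => by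
  rw [ContinuousLinearMap.adjoint_inner_left, hV, inner_creation σ hm h1, inner_tmul,
    ContinuousLinearMap.adjoint_inner_left, hX]

/-- Operators on `G ⊗_σ H` that agree on the vectors `(ξ ⊗ η) ⊗ h` are equal. -/
theorem ext_of_isCorrespondenceTensor (hσ : @Continuous _ _ N.sigmaWeak (sigmaWeakTopology H) σ)
    (hm : IsCorrespondenceTensor N m) {L : Type*} [NormedAddCommGroup L] [NormedSpace ℂ L]
    {A B : InducedSpace G σ →L[ℂ] L}
    (h : ∀ ξ η v, A (tmul σ (m ξ η) v) = B (tmul σ (m ξ η) v)) : A = B := by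
  refine ext fun ζ v => ?_
  refine closure_minimal ?_ (isClosed_eq A.continuous B.continuous)
    (tmul_mem_closure σ hσ hm.dense ζ v)
  rintro _ ⟨η, hη, rfl⟩
  change A (tmul σ η v) = B (tmul σ η v)
  induction hη using Submodule.span_induction with
  | mem x hx =>
    obtain ⟨p, rfl⟩ := hx
    exact h p.1 p.2 v
  | zero => simp [tmul]
  | add x y _ _ hx hy => rw [add_tmul, map_add, map_add, hx, hy]
  | smul c x _ hx => rw [smul_tmul, map_smul, map_smul, hx]

end InducedSpace

/-! ### The semigroup `Θ`. -/

namespace CovariantRep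

open HilbertModule CStarCorrespondence

variable {K : Type*} [NormedAddCommGroup K] [InnerProductSpace ℂ K] [CompleteSpace K]
  {N : VonNeumannAlgebra K} {E : ℝ≥0 → Type*} [∀ t, NormedAddCommGroup (E t)]
  [∀ t, NormedSpace ℂ (E t)] [∀ t, WStarCorrespondence N (E t)] {P : DiscreteProductSystem N E}
  {H : Type*} [NormedAddCommGroup H] [InnerProductSpace ℂ H] [CompleteSpace H]
  (R : CovariantRep P H)

theorem tilde_tmul (t : ℝ≥0) (ξ : E t) (h : H) :
    R.tilde t (InducedSpace.tmul R.σ ξ h) = R.T t ξ h :=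
  InducedSpace.tilde_tmul R.σ (R.T t) (R.completelyContractive t) (R.T_rsmul t) ξ h

theorem norm_tilde_le (t : ℝ≥0) : ‖R.tilde t‖ ≤ 1 :=
  InducedSpace.norm_tilde_le R.σ (R.T t) (R.completelyContractive t) (R.T_rsmul t)

theorem tilde_left (t : ℝ≥0) (a : N) :
    R.tilde t ∘L InducedSpace.left R.σ a = R.σ a ∘L R.tilde t :=
  InducedSpace.ext fun ξ h => by
    rw [ContinuousLinearMap.comp_apply, ContinuousLinearMap.comp_apply,
      InducedSpace.left_tmul R.σ (P.lsmul_one t), tilde_tmul, tilde_tmul, T_lsmul]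
    rfl

theorem left_adjoint_tilde (t : ℝ≥0) (a : N) (h : H) :
    InducedSpace.left R.σ a (ContinuousLinearMap.adjoint (R.tilde t) h)
      = ContinuousLinearMap.adjoint (R.tilde t) (R.σ a h) := by
  have e := congrArg ContinuousLinearMap.adjoint (R.tilde_left t (star a))
  rw [ContinuousLinearMap.adjoint_comp, ContinuousLinearMap.adjoint_comp,
    ← ContinuousLinearMap.star_eq_adjoint (InducedSpace.left R.σ (star a)),
    InducedSpace.star_left R.σ (P.lsmul_one t), star_star,
    ← ContinuousLinearMap.star_eq_adjoint (R.σ (star a)), ← map_star, star_star] at e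
  exact congrArg (fun A : H →L[ℂ] InducedSpace (E t) R.σ => A h) e

theorem theta_comm (t : ℝ≥0) (S : H →L[ℂ] H) (hS : ∀ a, S * R.σ a = R.σ a * S) (a : N) :
    R.theta t S * R.σ a = R.σ a * R.theta t S := by
  refine ContinuousLinearMap.ext fun h => ?_
  have h1 := congrArg (fun A => A (ContinuousLinearMap.adjoint (R.tilde t) h))
    (InducedSpace.left_ampl_comm R.σ (P.lsmul_one t) a S hS)
  have h2 := congrArg (fun A : InducedSpace (E t) R.σ →L[ℂ] H =>
    A (InducedSpace.ampl R.σ S (ContinuousLinearMap.adjoint (R.tilde t) h))) (R.tilde_left t a)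
  change R.tilde t (InducedSpace.ampl R.σ S (ContinuousLinearMap.adjoint (R.tilde t) (R.σ a h)))
    = R.σ a (R.tilde t (InducedSpace.ampl R.σ S (ContinuousLinearMap.adjoint (R.tilde t) h)))
  rw [← left_adjoint_tilde]
  exact (congrArg (R.tilde t) h1.symm).trans h2

/-- `V = 1 ⊗ T̃ₜ*` is built with values directly in `E(s + t) ⊗_σ H`, so no iterated induced space
is needed. Substituting `T̃ₛ₊ₜ = T̃ₛ V*` leaves `V* (1 ⊗ S) V = 1 ⊗ Θₜ(S)` in the middle. -/
theorem theta_add_time (s t : ℝ≥0) (S : H →L[ℂ] H) (hS : ∀ a, S * R.σ a = R.σ a * S) :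
    R.theta (s + t) S = R.theta s (R.theta t S) := by
  have hm := P.isTensor s t
  have h1 := P.lsmul_one t
  have hX := R.left_adjoint_tilde t
  obtain ⟨V, hV⟩ := InducedSpace.exists_amplify R.σ hm h1
    (ContinuousLinearMap.adjoint (R.tilde t)) hX
  have hVadj : ∀ ξ x, ContinuousLinearMap.adjoint V (InducedSpace.creation R.σ (P.mul s t) ξ x)
      = InducedSpace.tmul R.σ ξ (R.tilde t x) := fun ξ x => by
    rw [InducedSpace.adjoint_amplify_creation R.σ hm h1 _ hX V hV,
      ContinuousLinearMap.adjoint_adjoint]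
  have htilde : R.tilde (s + t) = R.tilde s ∘L ContinuousLinearMap.adjoint V :=
    InducedSpace.ext_of_isCorrespondenceTensor R.σ R.continuous_σ hm fun ξ η v => by
      rw [ContinuousLinearMap.comp_apply, ← InducedSpace.creation_tmul R.σ hm h1, hVadj,
        tilde_tmul, tilde_tmul, InducedSpace.creation_tmul R.σ hm h1, tilde_tmul, R.map_mul]
      rfl
  have hampl : ContinuousLinearMap.adjoint V ∘L InducedSpace.ampl R.σ S ∘L V
      = InducedSpace.ampl R.σ (R.theta t S) :=
    InducedSpace.ext fun ξ h => by
      rw [ContinuousLinearMap.comp_apply, ContinuousLinearMap.comp_apply, hV,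
        InducedSpace.ampl_creation R.σ hm h1 S hS, hVadj,
        InducedSpace.ampl_tmul R.σ _ (R.theta_comm t S hS)]
      rfl
  change _ = R.tilde s ∘L InducedSpace.ampl R.σ (R.theta t S) ∘L
    ContinuousLinearMap.adjoint (R.tilde s)
  rw [theta, htilde, ContinuousLinearMap.adjoint_comp, ContinuousLinearMap.adjoint_adjoint, ← hampl]
  rfl

theorem adjoint_tilde_zero (h : H) :
    ContinuousLinearMap.adjoint (R.tilde 0) h = InducedSpace.tmul R.σ (P.unit 1) h :=
  InducedSpace.ext_inner fun ξ k => by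
    obtain ⟨a, rfl⟩ := P.unit.surjective ξ
    rw [ContinuousLinearMap.adjoint_inner_left, tilde_tmul, InducedSpace.inner_tmul, P.ip_unit,
      star_one, one_mul]
    rfl

theorem theta_zero (S : H →L[ℂ] H) (hS : ∀ a, S * R.σ a = R.σ a * S) :
    R.theta 0 S = R.σ 1 * S := ContinuousLinearMap.ext fun h => by
  rw [theta, ContinuousLinearMap.comp_apply, ContinuousLinearMap.comp_apply, adjoint_tilde_zero,
    InducedSpace.ampl_tmul R.σ S hS, tilde_tmul]
  rfl

theorem theta_one (t : ℝ≥0) :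
    R.theta t 1 = R.tilde t ∘L ContinuousLinearMap.adjoint (R.tilde t) := by
  rw [theta, InducedSpace.ampl_one]
  rfl

theorem theta_add (t : ℝ≥0) (S S' : H →L[ℂ] H) (hS : ∀ a, S * R.σ a = R.σ a * S)
    (hS' : ∀ a, S' * R.σ a = R.σ a * S') :
    R.theta t (S + S') = R.theta t S + R.theta t S' := by
  rw [theta, InducedSpace.ampl_add R.σ S S' hS hS', ContinuousLinearMap.add_comp,
    ContinuousLinearMap.comp_add]
  rfl

theorem theta_smul (t : ℝ≥0) (c : ℂ) (S : H →L[ℂ] H) (hS : ∀ a, S * R.σ a = R.σ a * S) :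
    R.theta t (c • S) = c • R.theta t S := by
  rw [theta, InducedSpace.ampl_smul R.σ c S hS, ContinuousLinearMap.smul_comp,
    ContinuousLinearMap.comp_smul]
  rfl

theorem theta_star (t : ℝ≥0) (S : H →L[ℂ] H) (hS : ∀ a, S * R.σ a = R.σ a * S) :
    R.theta t (star S) = star (R.theta t S) := by
  rw [theta, theta, InducedSpace.ampl_star R.σ S hS, ContinuousLinearMap.star_eq_adjoint,
    ContinuousLinearMap.star_eq_adjoint, ContinuousLinearMap.adjoint_comp,
    ContinuousLinearMap.adjoint_comp, ContinuousLinearMap.adjoint_adjoint]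
  rfl

theorem norm_theta_le (t : ℝ≥0) (S : H →L[ℂ] H) (hS : ∀ a, S * R.σ a = R.σ a * S) :
    ‖R.theta t S‖ ≤ ‖S‖ := by
  have h1 : ‖ContinuousLinearMap.adjoint (R.tilde t)‖ ≤ 1 := by
    rw [LinearIsometryEquiv.norm_map]
    exact R.norm_tilde_le t
  calc ‖R.theta t S‖ ≤ ‖R.tilde t‖ * (‖InducedSpace.ampl (E := E t) R.σ S‖
        * ‖ContinuousLinearMap.adjoint (R.tilde t)‖) :=
        (ContinuousLinearMap.opNorm_comp_le _ _).trans
          (mul_le_mul_of_nonneg_left (ContinuousLinearMap.opNorm_comp_le _ _) (norm_nonneg _))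
    _ ≤ 1 * (‖S‖ * 1) := by
        gcongr
        · exact R.norm_tilde_le t
        · exact InducedSpace.norm_ampl_le R.σ S hS
    _ = ‖S‖ := by ring

/-- Isometry of `T` says that `T̃ₜ` preserves inner products of elementary tensors, so `T̃ₜ* T̃ₜ =
1` cancels between the two factors. -/
theorem theta_mul (hR : R.IsIsometric) (t : ℝ≥0) (S S' : H →L[ℂ] H)
    (hS : ∀ a, S * R.σ a = R.σ a * S) (hS' : ∀ a, S' * R.σ a = R.σ a * S') :
    R.theta t (S * S') = R.theta t S * R.theta t S' := by
  have h : ContinuousLinearMap.adjoint (R.tilde t) ∘L R.tilde t = 1 :=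
    InducedSpace.ext fun ξ h => InducedSpace.ext_inner fun η k => by
      rw [ContinuousLinearMap.comp_apply, ContinuousLinearMap.adjoint_inner_left, tilde_tmul,
        tilde_tmul, one_apply_eq_self, InducedSpace.inner_tmul, ← hR t ξ η,
        mul_apply_eq_comp, ContinuousLinearMap.star_eq_adjoint,
        ContinuousLinearMap.adjoint_inner_right]
  refine ContinuousLinearMap.ext fun v => ?_
  have h' : ∀ x, ContinuousLinearMap.adjoint (R.tilde t) (R.tilde t x) = x := fun x =>
    congrArg (fun A : InducedSpace (E t) R.σ →L[ℂ] InducedSpace (E t) R.σ => A x) h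
  rw [theta, InducedSpace.ampl_mul R.σ S S' hS hS']
  change R.tilde t (InducedSpace.ampl R.σ S (InducedSpace.ampl R.σ S' _))
    = R.tilde t (InducedSpace.ampl R.σ S (ContinuousLinearMap.adjoint (R.tilde t) (R.tilde t _)))
  rw [h']
  rfl

theorem comm_of_mem (S : repCommutant R.σ) (a : N) :
    (S : H →L[ℂ] H) * R.σ a = R.σ a * (S : H →L[ℂ] H) :=
  (mem_repCommutant R.σ).mp S.2 a

/-- The restriction of `S ↦ T̃ₜ (1 ⊗ S) T̃ₜ*` to the commutant of `T₀(N)`. -/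
def thetaLinear (t : ℝ≥0) : repCommutant R.σ →ₗ[ℂ] repCommutant R.σ where
  toFun S := ⟨R.theta t S, (mem_repCommutant R.σ).mpr (R.theta_comm t S (R.comm_of_mem S))⟩
  map_add' S S' := Subtype.ext (R.theta_add t S S' (R.comm_of_mem S) (R.comm_of_mem S'))
  map_smul' c S := Subtype.ext (R.theta_smul t c S (R.comm_of_mem S))

theorem sum_inner_ampl_nonneg (t : ℝ≥0) {n : ℕ}
    (Y : CStarMatrix (Fin n) (Fin n) (repCommutant R.σ)) (v : Fin n → InducedSpace (E t) R.σ) :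
    0 ≤ (∑ i, ∑ j, ⟪v i, InducedSpace.ampl R.σ ((star Y * Y) i j : H →L[ℂ] H) (v j)⟫_ℂ).re := by
  obtain ⟨A, hA⟩ : ∃ A : CStarMatrix (Fin n) (Fin n)
      (InducedSpace (E t) R.σ →L[ℂ] InducedSpace (E t) R.σ),
      ∀ i j, A i j = InducedSpace.ampl R.σ (Y i j : H →L[ℂ] H) :=
    ⟨CStarMatrix.ofMatrix (Matrix.of fun i j => InducedSpace.ampl R.σ (Y i j : H →L[ℂ] H)),
      fun i j => rfl⟩
  have e : ∀ i j, InducedSpace.ampl (E := E t) R.σ ((star Y * Y) i j : H →L[ℂ] H)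
      = (star A * A) i j := fun i j => by
    -- Additivity of `ampl` is available on the commutant only, so it is bundled there before it is
    -- applied to the sum in a matrix product.
    let amplAdd : repCommutant R.σ →+ (InducedSpace (E t) R.σ →L[ℂ] InducedSpace (E t) R.σ) :=
      AddMonoidHom.mk' (fun S => InducedSpace.ampl R.σ (S : H →L[ℂ] H)) fun S S' =>
        InducedSpace.ampl_add R.σ S S' (R.comm_of_mem S) (R.comm_of_mem S')
    change amplAdd ((star Y * Y) i j) = _
    rw [CStarMatrix.mul_apply, map_sum, CStarMatrix.mul_apply]
    refine Finset.sum_congr rfl fun k _ => ?_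
    rw [CStarMatrix.star_apply, CStarMatrix.star_apply, hA, hA]
    change InducedSpace.ampl R.σ (star (Y k i : H →L[ℂ] H) * (Y k j : H →L[ℂ] H)) = _
    rw [InducedSpace.ampl_mul R.σ _ _ (InducedSpace.star_commute R.σ (R.comm_of_mem (Y k i)))
      (R.comm_of_mem (Y k j)), InducedSpace.ampl_star R.σ _ (R.comm_of_mem (Y k i))]
  simp only [e]
  rw [CStarMatrix.sum_norm_sq_mulVec A v, Complex.ofReal_re]
  exact Finset.sum_nonneg fun i _ => sq_nonneg _

/-- The form of `Θₜ(M)` at `(vᵢ)` is the form of `1 ⊗ M` at `(T̃ₜ* vᵢ)`, and positivity over the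
commutant can be tested on `Hⁿ`. -/
theorem map_thetaLinear_nonneg (t : ℝ≥0) {n : ℕ}
    (M : CStarMatrix (Fin n) (Fin n) (repCommutant R.σ)) (hsa : IsSelfAdjoint M)
    (hM : ∀ v : Fin n → InducedSpace (E t) R.σ,
      0 ≤ (∑ i, ∑ j, ⟪v i, InducedSpace.ampl R.σ (M i j : H →L[ℂ] H) (v j)⟫_ℂ).re) :
    0 ≤ M.map (R.thetaLinear t) := by
  refine VonNeumannAlgebra.cstarMatrix_nonneg _ _ ?_ fun v => ?_
  · refine CStarMatrix.ext fun i j => Subtype.ext ?_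
    rw [CStarMatrix.star_apply]
    change star (R.theta t (M j i : H →L[ℂ] H)) = R.theta t (M i j : H →L[ℂ] H)
    rw [← R.theta_star t (M j i : H →L[ℂ] H) (R.comm_of_mem (M j i))]
    have h : star (M j i) = M i j := by rw [← CStarMatrix.star_apply, hsa.star_eq]
    have h' : star (M j i : H →L[ℂ] H) = (M i j : H →L[ℂ] H) := by
      rw [← h]
      rfl
    rw [h']
  · have h := hM fun i => ContinuousLinearMap.adjoint (R.tilde t) (v i)
    refine h.trans_eq (congrArg Complex.re (Finset.sum_congr rfl fun i _ =>
      Finset.sum_congr rfl fun j _ => ?_))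
    rw [ContinuousLinearMap.adjoint_inner_left]
    rfl

theorem _root_.exists_eq_star_mul_self_of_nonneg {B : Type*} [CStarAlgebra B] [PartialOrder B]
    [StarOrderedRing B] {b : B} (hb : 0 ≤ b) : ∃ y : B, b = star y * y :=
  CStarAlgebra.nonneg_iff_eq_star_mul_self.mp hb

/-- The completely positive map `S ↦ T̃ₜ (1 ⊗ S) T̃ₜ*` on the commutant of `T₀(N)`. -/
def thetaCP (t : ℝ≥0) : repCommutant R.σ →CP repCommutant R.σ where
  toLinearMap := R.thetaLinear t
  map_cstarMatrix_nonneg' n M hM := by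
    obtain ⟨Y, rfl⟩ := exists_eq_star_mul_self_of_nonneg hM
    exact R.map_thetaLinear_nonneg t _ (IsSelfAdjoint.star_mul_self Y)
      (R.sum_inner_ampl_nonneg t Y)

end CovariantRep

end

theorem mainTheorem8 {K : Type*} [NormedAddCommGroup K] [InnerProductSpace ℂ K] [CompleteSpace K]
    (N : VonNeumannAlgebra K) (E : ℝ≥0 → Type*) [∀ t, NormedAddCommGroup (E t)]
    [∀ t, NormedSpace ℂ (E t)] [∀ t, CompleteSpace (E t)] [∀ t, WStarCorrespondence N (E t)]
    (P : DiscreteProductSystem N E)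
    {H : Type*} [NormedAddCommGroup H] [InnerProductSpace ℂ H] [CompleteSpace H]
    (R : CovariantRep P H) :
    -- the operators `T̃ₜ` are well defined contractions
    (∀ t, (∀ ξ h, R.tilde t (InducedSpace.tmul R.σ ξ h) = R.T t ξ h) ∧ ‖R.tilde t‖ ≤ 1) ∧
    ∃ Θ : ℝ≥0 → (repCommutant R.σ →CP repCommutant R.σ),
      (∀ t S, (Θ t S : H →L[ℂ] H) = R.theta t S) ∧
      -- a semigroup of normal contractive (completely positive) maps
      (∀ s t S, Θ (s + t) S = Θ s (Θ t S)) ∧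
      (∀ S, (Θ 0 S : H →L[ℂ] H) = R.σ 1 * S) ∧
      (∀ t, @Continuous _ _ (repCommutant R.σ).sigmaWeak (repCommutant R.σ).sigmaWeak (Θ t)) ∧
      (∀ t S, ‖Θ t S‖ ≤ ‖S‖) ∧
      -- unital if and only if `T` is fully coisometric
      ((∀ t, Θ t 1 = 1) ↔ R.IsFullyCoisometric) ∧
      -- `*`-endomorphisms if `T` is isometric
      (R.IsIsometric → ∀ t, ∃ φ : repCommutant R.σ →⋆ₙₐ[ℂ] repCommutant R.σ, ∀ S, φ S = Θ t S) := by
  refine ⟨fun t => ⟨R.tilde_tmul t, R.norm_tilde_le t⟩, R.thetaCP, fun t S => rfl,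
    fun s t S => Subtype.ext (R.theta_add_time s t S (R.comm_of_mem S)),
    fun S => R.theta_zero S (R.comm_of_mem S),
    fun t => InducedSpace.continuous_compression_ampl R.σ (R.tilde t) _ fun S => rfl,
    fun t S => R.norm_theta_le t S (R.comm_of_mem S), ?_, fun hR t => ?_⟩
  · refine forall_congr' fun t => ?_
    rw [← R.theta_one]
    exact ⟨fun h => congrArg Subtype.val h, fun h => Subtype.ext h⟩
  · exact ⟨{ (R.thetaLinear t) with
        map_zero' := map_zero (R.thetaLinear t)
        map_mul' := fun S S' =>
          Subtype.ext (R.theta_mul hR t S S' (R.comm_of_mem S) (R.comm_of_mem S'))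
        map_star' := fun S => Subtype.ext (R.theta_star t S (R.comm_of_mem S)) }, fun S => rfl⟩
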